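/- Let $\mathcal H$ be a separable complex Hilbert space with orthonormal basis $(e_n)$, let $\mathcal T(\mathcal H)$ be its trace class operators and $S(\mathcal H)$ its states (positive operators of trace one), and let $X$ be a measurable space. A quantum random variable is a map $f:X\to\mathcal B(\mathcal H)$ such that $x\mapsto\operatorname{tr}(s f(x))$ is measurable for every $s\in S(\mathcal H)$. Let $\nu$ be a positive operator-valued measure on $X$ with values in $\mathcal B(\mathcal H)$, i.e. an ultraweakly countably additive map from the measurable sets to the positive operators. Let $\rho\in S(\mathcal H)$ be of full rank (injective), and let $\nu_\rho$ be the finite positive measure $\nu_\rho(E)=\operatorname{tr}(\rho\,\nu(E))$. Suppose that the Radon–Nikodým derivative $D=\frac{d\nu}{d\nu_\rho}$ exists, i.e. $D:X\to\mathcal B(\mathcal H)$ is a quantum random variable whose matrix entries $\langle D(\cdot)e_j,e_i\rangle$ are $\nu_\rho$-integrable with $\int_E\langle D(x)e_j,e_i\rangle\,d\nu_\rho(x)=\langle\nu(E)e_j,e_i\rangle$ for all $i,j$ and all measurable $E$ (then $D(x)\ge 0$ for $\nu_\rho$-almost every $x$). For a quantum random variable $f$ and $s\in S(\mathcal H)$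 put $f_s(x)=\operatorname{tr}\big(s\,D(x)^{1/2}f(x)D(x)^{1/2}\big)$. If $f\ge 0$, then $f$ is called $\nu$-integrable if $f_s$ is $\nu_\rho$-integrable for every $s\in S(\mathcal H)$; a general $f$ is $\nu$-integrable if the positive and negative parts of its real and imaginary parts are. For $\nu$-integrable $f$, the integral $\int_X f\,d\nu\in\mathcal B(\mathcal H)$ is defined by $\operatorname{tr}\big(s\int_X f\,d\nu\big)=\int_X f_s\,d\nu_\rho$ for all $s\in S(\mathcal H)$. Let $L^\infty_{\mathcal H}(X,\nu)\cong L^\infty(X,\nu_\rho)\,\overline\otimes\,\mathcal B(\mathcal H)$ be the space of $\nu$-essentially bounded quantum random variables modulo equality $\nu$-almost everywhere. Its predual is $L^1(X,\nu_\rho)\,\overline\otimes\,\mathcal T(\mathcal H)=L^1(X,\nu_\rho;\mathcal T(\mathcal H))$, that is, the quantum random variables $g$ with $\int_X\|g(x)\|_1\,d\nu_\rho(x)<\infty$ (modulo equality almost everywhere), with the pairing $\langle g,f\rangle=\int_X\operatorname{tr}(g(x)f(x))\,d\nu_\rho(x)$; the weak* topology of $L^\infty_{\mathcal H}(X,\nu)$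 is the coarsest one that makes all these pairings continuous. The weak* topology of $\mathcal B(\mathcal H)=\mathcal T(\mathcal H)^*$ is the ultraweak one, given by the functionals $A\mapsto\operatorname{tr}(tA)$, $t\in\mathcal T(\mathcal H)$. **Theorem.** Every $f\in L^\infty_{\mathcal H}(X,\nu)$ is $\nu$-integrable and has a unique integral $\mathbb E_\nu(f)=\int_X f\,d\nu\in\mathcal B(\mathcal H)$. For every $s\in\mathcal T(\mathcal H)$, the function $x\mapsto D(x)^{1/2}\,s\,D(x)^{1/2}$ belongs to the predual $L^1(X,\nu_\rho)\,\overline\otimes\,\mathcal T(\mathcal H)$. The quantum expected value map $\mathbb E_\nu:L^\infty_{\mathcal H}(X,\nu)\to\mathcal B(\mathcal H)$ is weak*–weak* continuous. -/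

import Mathlib

open MeasureTheory Filter Topology ComplexStarModule
open scoped ENNReal

noncomputable section

namespace QuantumExpectation

variable {H : Type*} [NormedAddCommGroup H] [InnerProductSpace ℂ H] [CompleteSpace H]
variable {ι : Type*} {X : Type*} [MeasurableSpace X]

/-! ### Trace class operators, states, the ultraweak topology -/

/-- The trace norm `‖T‖₁ = ∑ ⟨|T| eᵢ, eᵢ⟩ ∈ [0, ∞]`, where `|T| = (T* T)^{1/2}`.
It does not depend on the orthonormal basis. -/
def traceNorm (b : HilbertBasis ι ℂ H) (T : H →L[ℂ] H) : ℝ≥0∞ :=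
  ∑' i, ENNReal.ofReal (inner ℂ (b i) (CFC.abs T (b i))).re

/-- `T ∈ T(H)`: the operator `T` is of trace class. -/
def IsTraceClass (b : HilbertBasis ι ℂ H) (T : H →L[ℂ] H) : Prop :=
  traceNorm b T < ∞

/-- The trace `∑ ⟨T eᵢ, eᵢ⟩`, meant for trace class `T`, where the series converges absolutely and
does not depend on the orthonormal basis. (Mathlib's inner product is linear in the second
variable.) -/
def trace (b : HilbertBasis ι ℂ H) (T : H →L[ℂ] H) : ℂ :=
  ∑' i, inner ℂ (b i) (T (b i))

/-- The set `S(H)` of states (density operators): positive operators of unit trace. -/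
structure State (b : HilbertBasis ι ℂ H) where
  op : H →L[ℂ] H
  nonneg : 0 ≤ op
  isTraceClass : IsTraceClass b op
  trace_eq_one : trace b op = 1

/-- A state is full-rank if its kernel is trivial (equivalently, as it is self-adjoint, if its range
is dense). -/
def State.FullRank {b : HilbertBasis ι ℂ H} (ρ : State b) : Prop :=
  Function.Injective ρ.op

/-- The ultraweak (weak*) topology `σ(B(H), T(H))` on `B(H)`: the coarsest topology such that
`A ↦ tr(t A)` is continuous for every trace class operator `t`. -/
@[reducible] def ultraweak (b : HilbertBasis ι ℂ H) : TopologicalSpace (H →L[ℂ] H) :=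
  ⨅ t : {t : H →L[ℂ] H // IsTraceClass b t},
    TopologicalSpace.induced (fun A => trace b (t.1 * A)) inferInstance

/-! Helper facts on traces against positive trace class operators. -/

lemma inner_sqrt {P : H →L[ℂ] H} (hP : 0 ≤ P) (x y : H) :
    inner ℂ (CFC.sqrt P x) (CFC.sqrt P y) = inner ℂ x (P y) := by
  have h1 : IsSelfAdjoint (CFC.sqrt P) := IsSelfAdjoint.of_nonneg (CFC.sqrt_nonneg P)
  have h2 : CFC.sqrt P (CFC.sqrt P y) = P y := by
    rw [← mul_apply_eq_comp, CFC.sqrt_mul_sqrt_self P hP]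
  conv_rhs => rw [← h2]
  rw [← ContinuousLinearMap.adjoint_inner_left (CFC.sqrt P) (CFC.sqrt P y) x, h1.adjoint_eq]

set_option linter.unusedSectionVars false in
lemma hasSum_norm_sq (b : HilbertBasis ι ℂ H) (x : H) :
    HasSum (fun i => ‖inner ℂ (b i) x‖ ^ 2) (‖x‖ ^ 2) := by
  have h := (Complex.hasSum_re (b.hasSum_inner_mul_inner x x))
  convert h using 1
  · ext i
    rw [← inner_conj_symm x (b i), mul_comm, RCLike.mul_conj]
    norm_cast
  · rw [inner_self_eq_norm_sq_to_K]
    norm_cast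

lemma summable_sqrt {b : HilbertBasis ι ℂ H} {P : H →L[ℂ] H} (hP : 0 ≤ P)
    (hT : IsTraceClass b P) : Summable fun i => ‖CFC.sqrt P (b i)‖ ^ 2 := by
  have h0 : ∀ i, (inner ℂ (b i) (P (b i))).re = ‖CFC.sqrt P (b i)‖ ^ 2 := by
    intro i
    rw [← inner_sqrt hP, inner_self_eq_norm_sq_to_K]
    norm_cast
  unfold IsTraceClass traceNorm at hT
  rw [CFC.abs_of_nonneg P hP] at hT
  simp only [h0] at hT
  have := ENNReal.summable_toReal hT.ne
  refine this.congr fun i => ?_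
  rw [ENNReal.toReal_ofReal (by positivity)]

lemma summable_prod_norm_sq {b : HilbertBasis ι ℂ H} {S : H →L[ℂ] H}
    (hS : Summable fun i => ‖S (b i)‖ ^ 2) :
    Summable fun p : ι × ι => ‖inner ℂ (b p.2) (S (b p.1))‖ ^ 2 := by
  rw [summable_prod_of_nonneg (fun p => sq_nonneg _)]
  refine ⟨fun i => (hasSum_norm_sq b (S (b i))).summable, hS.congr fun i => ?_⟩
  exact (hasSum_norm_sq b (S (b i))).tsum_eq.symm

lemma hasSum_trace_mul {b : HilbertBasis ι ℂ H} {P : H →L[ℂ] H} (hP : 0 ≤ P)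
    (hT : IsTraceClass b P) (A : H →L[ℂ] H) :
    HasSum (fun i => inner ℂ (b i) ((P * A) (b i))) (trace b (P * A)) ∧
    HasSum (fun i => inner ℂ (CFC.sqrt P (b i)) (A (CFC.sqrt P (b i)))) (trace b (P * A)) := by
  obtain ⟨R, hR⟩ : ∃ R, R = CFC.sqrt P := ⟨_, rfl⟩
  have hRs : IsSelfAdjoint R := hR ▸ IsSelfAdjoint.of_nonneg (CFC.sqrt_nonneg P)
  have hsw : ∀ x y, inner ℂ (R x) y = inner ℂ x (R y) := fun x y => by
    rw [← ContinuousLinearMap.adjoint_inner_left, hRs.adjoint_eq]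
  have hs := summable_sqrt hP hT
  have hq : ∀ x y, inner ℂ (R x) (R y) = inner ℂ x (P y) := fun x y => by rw [hR, inner_sqrt hP]
  rw [← hR] at hs ⊢
  clear hR
  let F : ι × ι → ℂ := fun p =>
    inner ℂ (R (b p.1)) (b p.2) * inner ℂ (b p.2) (R (A (b p.1)))
  have hF : Summable F := by
    obtain ⟨B, hB⟩ : ∃ B, B = ContinuousLinearMap.adjoint A := ⟨_, rfl⟩
    have h1 := summable_prod_norm_sq hs
    have h2 : Summable fun p : ι × ι => ‖inner ℂ (b p.2) ((B * R) (b p.1))‖ ^ 2 := by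
      refine summable_prod_norm_sq (Summable.of_nonneg_of_le (fun i => sq_nonneg _) (fun i => ?_)
        (hs.mul_left (‖B‖ ^ 2)))
      rw [← mul_pow]
      exact pow_le_pow_left₀ (norm_nonneg _) (B.le_opNorm _) 2
    have h3 := h1.add ((Equiv.prodComm ι ι).summable_iff.mpr h2)
    refine Summable.of_norm_bounded h3 fun p => ?_
    have e1 : ‖inner ℂ (R (b p.1)) (b p.2)‖ = ‖inner ℂ (b p.2) (R (b p.1))‖ :=
      norm_inner_symm _ _
    have e2 : ‖inner ℂ (b p.2) (R (A (b p.1)))‖ = ‖inner ℂ (b p.1) (B (R (b p.2)))‖ := by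
      rw [← hsw, hB, ← ContinuousLinearMap.adjoint_inner_left, norm_inner_symm]
    have e3 : ‖F p‖ = ‖inner ℂ (b p.2) (R (b p.1))‖ * ‖inner ℂ (b p.1) (B (R (b p.2)))‖ := by
      rw [norm_mul, e1, e2]
    have e4 : ∀ u v : ℝ, u * v ≤ u ^ 2 + v ^ 2 := fun u v => by
      nlinarith [sq_nonneg (u - v), sq_nonneg u, sq_nonneg v]
    rw [e3]
    exact e4 _ _
  have ha : ∀ i, HasSum (fun j => F (i, j)) (inner ℂ (b i) ((P * A) (b i))) := by
    intro i
    have := b.hasSum_inner_mul_inner (R (b i)) (R (A (b i)))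
    rwa [hq] at this
  have hb : ∀ j, HasSum (fun i => F (i, j)) (inner ℂ (R (b j)) (A (R (b j)))) := by
    intro j
    have := b.hasSum_inner_mul_inner ((ContinuousLinearMap.adjoint A) (R (b j))) (R (b j))
    rw [ContinuousLinearMap.adjoint_inner_left] at this
    have e : ∀ i, F (i, j) =
        inner ℂ ((ContinuousLinearMap.adjoint A) (R (b j))) (b i) * inner ℂ (b i) (R (b j)) := by
      intro i
      change inner ℂ (R (b i)) (b j) * inner ℂ (b j) (R (A (b i))) = _
      rw [hsw, ← hsw (b j), ← ContinuousLinearMap.adjoint_inner_left A (b i) (R (b j)), mul_comm]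
    simpa only [e] using this
  have h1 := hF.hasSum.prod_fiberwise ha
  have h2 := ((Equiv.prodComm ι ι).hasSum_iff.mpr hF.hasSum).prod_fiberwise hb
  have h3 : trace b (P * A) = ∑' p, F p := h1.tsum_eq
  rw [h3]
  exact ⟨h1, h2⟩

namespace State

variable {b : HilbertBasis ι ℂ H} (s : State b)

lemma trace_add (A B : H →L[ℂ] H) :
    trace b (s.op * (A + B)) = trace b (s.op * A) + trace b (s.op * B) := by
  have h := (hasSum_trace_mul s.nonneg s.isTraceClass A).1.add
    (hasSum_trace_mul s.nonneg s.isTraceClass B).1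
  rw [← h.tsum_eq, trace]
  simp [mul_add]

lemma trace_smul (c : ℂ) (A : H →L[ℂ] H) :
    trace b (s.op * (c • A)) = c * trace b (s.op * A) := by
  have h := (hasSum_trace_mul s.nonneg s.isTraceClass A).1.mul_left c
  rw [← h.tsum_eq, trace]
  simp

lemma trace_zero : trace b (s.op * 0) = 0 := by simp [trace]

lemma trace_sum {κ : Type*} (t : Finset κ) (A : κ → H →L[ℂ] H) :
    trace b (s.op * ∑ k ∈ t, A k) = ∑ k ∈ t, trace b (s.op * A k) := by
  classical
  induction t using Finset.induction_on with
  | empty => simpa using s.trace_zero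
  | insert k t hk ih => rw [Finset.sum_insert hk, Finset.sum_insert hk, s.trace_add, ih]

lemma trace_nonneg {A : H →L[ℂ] H} (hA : 0 ≤ A) :
    0 ≤ (trace b (s.op * A)).re ∧ (trace b (s.op * A)).im = 0 := by
  have h := (hasSum_trace_mul s.nonneg s.isTraceClass A).2
  have hp : ∀ x, 0 ≤ (inner ℂ x (A x)).re ∧ (inner ℂ x (A x)).im = 0 := by
    intro x
    rw [← inner_sqrt hA, inner_self_eq_norm_sq_to_K, RCLike.ofReal_eq_complex_ofReal,
      ← Complex.ofReal_pow]
    exact ⟨by rw [Complex.ofReal_re]; positivity, Complex.ofReal_im _⟩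
  refine ⟨(Complex.hasSum_re h).nonneg fun i => (hp _).1, ?_⟩
  have h2 := Complex.hasSum_im h
  simp only [(hp _).2] at h2
  exact h2.unique hasSum_zero

end State

/-- The pure state `ξ ↦ ⟨v, ξ⟩ v` given by a unit vector `v`. -/
def pureState (b : HilbertBasis ι ℂ H) (v : H) (hv : ‖v‖ = 1) : State b where
  op := InnerProductSpace.rankOne ℂ v v
  nonneg := by
    rw [ContinuousLinearMap.nonneg_iff_isPositive]
    exact InnerProductSpace.isPositive_rankOne_self v
  isTraceClass := by
    have h0 : (0 : H →L[ℂ] H) ≤ InnerProductSpace.rankOne ℂ v v := by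
      rw [ContinuousLinearMap.nonneg_iff_isPositive]
      exact InnerProductSpace.isPositive_rankOne_self v
    unfold IsTraceClass traceNorm
    rw [CFC.abs_of_nonneg _ h0]
    have h : ∀ i, (inner ℂ (b i) (InnerProductSpace.rankOne ℂ v v (b i))).re
        = ‖inner ℂ (b i) v‖ ^ 2 := by
      intro i
      rw [InnerProductSpace.rankOne_apply, inner_smul_right, ← inner_conj_symm v (b i), mul_comm,
        RCLike.mul_conj]
      norm_cast
    simp only [h]
    rw [← ENNReal.ofReal_tsum_of_nonneg (fun i => by positivity) (hasSum_norm_sq b v).summable]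
    exact ENNReal.ofReal_lt_top
  trace_eq_one := by
    have h := b.hasSum_inner_mul_inner v v
    rw [inner_self_eq_norm_sq_to_K, hv] at h
    rw [trace]
    convert h.tsum_eq using 1
    · congr 1
      ext i
      rw [InnerProductSpace.rankOne_apply, inner_smul_right]
    · simp

lemma trace_pureState (b : HilbertBasis ι ℂ H) (v : H) (hv : ‖v‖ = 1) (A : H →L[ℂ] H) :
    trace b ((pureState b v hv).op * A) = inner ℂ v (A v) := by
  have h := b.hasSum_inner_mul_inner (ContinuousLinearMap.adjoint A v) v
  rw [ContinuousLinearMap.adjoint_inner_left] at h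
  rw [trace, ← h.tsum_eq]
  congr 1
  ext i
  rw [mul_apply_eq_comp, pureState, InnerProductSpace.rankOne_apply, inner_smul_right,
    ContinuousLinearMap.adjoint_inner_left]

/-! ### Positive operator-valued measures -/

/-- A positive operator-valued measure on the measurable space `X` with values in `B(H)`: a map on
measurable sets (the values on other sets are irrelevant) that takes positive values and is
countably additive for the ultraweak topology. -/
structure POVM (X : Type*) [MeasurableSpace X] (b : HilbertBasis ι ℂ H) where
  toFun : Set X → (H →L[ℂ] H)
  nonneg : ∀ E, MeasurableSet E → 0 ≤ toFun E
  tendsto_iUnion : ∀ E : ℕ → Set X, (∀ k, MeasurableSet (E k)) →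
    Pairwise (Function.onFun Disjoint E) →
    Tendsto (fun n => ∑ k ∈ Finset.range n, toFun (E k)) atTop
      (@nhds _ (ultraweak b) (toFun (⋃ k, E k)))

namespace POVM

variable {b : HilbertBasis ι ℂ H} (ν : POVM X b)

lemma tendsto_trace (s : State b) (E : ℕ → Set X) (hE : ∀ k, MeasurableSet (E k))
    (hd : Pairwise (Function.onFun Disjoint E)) :
    Tendsto (fun n => ∑ k ∈ Finset.range n, trace b (s.op * ν.toFun (E k))) atTop
      (𝓝 (trace b (s.op * ν.toFun (⋃ k, E k)))) := by
  have hc : @Continuous _ _ (ultraweak b) _ (fun A => trace b (s.op * A)) :=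
    continuous_iInf_dom (i := ⟨s.op, s.isTraceClass⟩) continuous_induced_dom
  have h := (@Continuous.tendsto _ _ (ultraweak b) _ _ hc (ν.toFun (⋃ k, E k))).comp
    (ν.tendsto_iUnion E hE hd)
  refine h.congr fun n => ?_
  simp only [Function.comp, s.trace_sum]

lemma trace_empty (s : State b) : trace b (s.op * ν.toFun ∅) = 0 := by
  have h := ν.tendsto_trace s (fun _ => ∅) (fun _ => MeasurableSet.empty)
    (fun _ _ _ => by simp [Function.onFun])
  simp only [Set.iUnion_empty] at h
  have h' := (h.comp (tendsto_add_atTop_nat 1)).sub h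
  simp only [Function.comp, Finset.sum_range_succ, add_sub_cancel_left, sub_self] at h'
  exact tendsto_nhds_unique tendsto_const_nhds h'

lemma hasSum_trace_re (s : State b) (E : ℕ → Set X) (hE : ∀ k, MeasurableSet (E k))
    (hd : Pairwise (Function.onFun Disjoint E)) :
    HasSum (fun k => (trace b (s.op * ν.toFun (E k))).re)
      (trace b (s.op * ν.toFun (⋃ k, E k))).re := by
  rw [hasSum_iff_tendsto_nat_of_nonneg fun k => (s.trace_nonneg (ν.nonneg _ (hE k))).1]
  have h := (Complex.continuous_re.tendsto _).comp (ν.tendsto_trace s E hE hd)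
  refine h.congr fun n => ?_
  simp [Function.comp]

/-- The (finite positive) measure `ν_ρ(E) = tr(ρ ν(E))` induced by a POVM and a state. The trace is
a nonnegative real number, see `ofReal_inducedMeasure`. -/
def inducedMeasure (s : State b) : Measure X :=
  Measure.ofMeasurable (fun E _ => ENNReal.ofReal (trace b (s.op * ν.toFun E)).re)
    (by simp [ν.trace_empty s])
    (fun E hE hd => by
      have h := ν.hasSum_trace_re s E hE hd
      rw [← h.tsum_eq, ENNReal.ofReal_tsum_of_nonneg
        (fun k => (s.trace_nonneg (ν.nonneg _ (hE k))).1) h.summable])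

lemma inducedMeasure_apply (s : State b) {E : Set X} (hE : MeasurableSet E) :
    ν.inducedMeasure s E = ENNReal.ofReal (trace b (s.op * ν.toFun E)).re :=
  Measure.ofMeasurable_apply E hE

lemma ofReal_inducedMeasure (s : State b) {E : Set X} (hE : MeasurableSet E) :
    (((ν.inducedMeasure s E).toReal : ℝ) : ℂ) = trace b (s.op * ν.toFun E) := by
  have h := s.trace_nonneg (ν.nonneg E hE)
  rw [ν.inducedMeasure_apply s hE, ENNReal.toReal_ofReal h.1]
  exact Complex.ext (by simp) (by simp [h.2])

instance (s : State b) : IsFiniteMeasure (ν.inducedMeasure s) :=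
  ⟨by rw [ν.inducedMeasure_apply s MeasurableSet.univ]; exact ENNReal.ofReal_lt_top⟩

lemma eq_zero_iff {E : Set X} (hE : MeasurableSet E) :
    ν.toFun E = 0 ↔ ∀ s : State b, ν.inducedMeasure s E = 0 := by
  constructor
  · intro h s
    rw [ν.inducedMeasure_apply s hE, h, s.trace_zero]
    simp
  · intro h
    have h0 : ∀ s : State b, trace b (s.op * ν.toFun E) = 0 := fun s => by
      rw [← ν.ofReal_inducedMeasure s hE, h s]
      simp
    have hz : CFC.sqrt (ν.toFun E) = 0 := by
      ext x
      by_cases hx : x = 0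
      · simp [hx]
      have hn : ‖x‖ ≠ 0 := norm_ne_zero_iff.mpr hx
      have hv : ‖((‖x‖⁻¹ : ℝ) : ℂ) • x‖ = 1 := by
        rw [norm_smul]
        simp [hn]
      have h1 := h0 (pureState b _ hv)
      rw [trace_pureState, ← inner_sqrt (ν.nonneg E hE), inner_self_eq_zero, map_smul,
        smul_eq_zero] at h1
      rcases h1 with h1 | h1
      · simp [hn] at h1
      · simpa using h1
    rw [← CFC.sqrt_mul_sqrt_self (ν.toFun E) (ν.nonneg E hE), hz, mul_zero]

lemma union_eq_zero {E F : Set X} (hE : MeasurableSet E) (hF : MeasurableSet F)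
    (h1 : ν.toFun E = 0) (h2 : ν.toFun F = 0) : ν.toFun (E ∪ F) = 0 := by
  rw [ν.eq_zero_iff (hE.union hF)]
  intro s
  exact measure_union_null ((ν.eq_zero_iff hE).1 h1 s) ((ν.eq_zero_iff hF).1 h2 s)

/-- The filter of properties that hold `ν`-almost everywhere, i.e. outside a measurable set `E`
with `ν(E) = 0`. -/
def ae : Filter X where
  sets := {s | ∃ E, MeasurableSet E ∧ sᶜ ⊆ E ∧ ν.toFun E = 0}
  univ_sets := ⟨∅, MeasurableSet.empty, by simp, by
    rw [ν.eq_zero_iff MeasurableSet.empty]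
    simp⟩
  sets_of_superset := fun ⟨E, h1, h2, h3⟩ hst =>
    ⟨E, h1, (Set.compl_subset_compl.mpr hst).trans h2, h3⟩
  inter_sets := fun ⟨E, h1, h2, h3⟩ ⟨F, h4, h5, h6⟩ =>
    ⟨E ∪ F, h1.union h4, by rw [Set.compl_inter]; exact Set.union_subset_union h2 h5,
      ν.union_eq_zero h1 h4 h3 h6⟩

lemma ae_inducedMeasure_le (s : State b) : MeasureTheory.ae (ν.inducedMeasure s) ≤ ν.ae := by
  rintro t ⟨E, h1, h2, h3⟩
  exact measure_mono_null h2 ((ν.eq_zero_iff h1).1 h3 s)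

end POVM

/-! ### Quantum random variables, the space `L^∞_H(X, ν)` and its predual -/

/-- Quantum random variables: `x ↦ tr(s f(x))` is measurable for every state `s`. -/
def IsQuantumRandomVariable (b : HilbertBasis ι ℂ H) (f : X → (H →L[ℂ] H)) : Prop :=
  ∀ s : State b, Measurable fun x => trace b (s.op * f x)

namespace POVM

variable {b : HilbertBasis ι ℂ H} (ν : POVM X b)

/-- The vector space of quantum random variables which are essentially bounded with respect to `ν`
(before identification of almost everywhere equal functions). -/
def EssBounded : Submodule ℂ (X → (H →L[ℂ] H)) where
  carrier := {f | IsQuantumRandomVariable b f ∧ ∃ M : ℝ, ∀ᶠ x in ν.ae, ‖f x‖ ≤ M}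
  zero_mem' := ⟨fun s => by simp [trace], 0, by simp⟩
  add_mem' := by
    rintro f g ⟨hf, M, hM⟩ ⟨hg, N, hN⟩
    refine ⟨fun s => ?_, M + N, ?_⟩
    · simp only [Pi.add_apply, s.trace_add]
      exact (hf s).add (hg s)
    · filter_upwards [hM, hN] with x h1 h2
      exact (norm_add_le _ _).trans (add_le_add h1 h2)
  smul_mem' := by
    rintro c f ⟨hf, M, hM⟩
    refine ⟨fun s => ?_, ‖c‖ * M, ?_⟩
    · simp only [Pi.smul_apply, s.trace_smul]
      exact (hf s).const_mul c
    · filter_upwards [hM] with x h1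
      rw [Pi.smul_apply, norm_smul]
      gcongr

/-- The essentially bounded quantum random variables that vanish `ν`-almost everywhere. -/
def nullFunctions : Submodule ℂ ν.EssBounded where
  carrier := {f | f.1 =ᶠ[ν.ae] 0}
  zero_mem' := EventuallyEq.refl ν.ae (0 : X → (H →L[ℂ] H))
  add_mem' := fun {f g} (hf : f.1 =ᶠ[ν.ae] 0) (hg : g.1 =ᶠ[ν.ae] 0) => by
    have h : f.1 + g.1 =ᶠ[ν.ae] 0 := by simpa using hf.add hg
    exact h
  smul_mem' := fun c f (hf : f.1 =ᶠ[ν.ae] 0) => by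
    have h : c • f.1 =ᶠ[ν.ae] 0 := by simpa using hf.const_smul c
    exact h

/-- The space `L^∞_H(X, ν)` of (classes of) essentially bounded quantum random variables. -/
abbrev Linfty : Type _ := ν.EssBounded ⧸ ν.nullFunctions

variable {ν} in
lemma ae_eq_of_rel {f g : ν.EssBounded} (h : (Submodule.quotientRel ν.nullFunctions) f g) :
    f.1 =ᶠ[ν.ae] g.1 := by
  rw [Submodule.quotientRel_def] at h
  have h' : (f - g).1 =ᶠ[ν.ae] 0 := h
  filter_upwards [h'] with x hx
  simpa [sub_eq_zero] using hx

/-- The elements of the predual `L^1(X, ν_ρ) ⊗̄ T(H) = L^1(X, ν_ρ; T(H))`, as functions: measurable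
`g` with `∫ ‖g(x)‖₁ dν_ρ(x) < ∞` (so `g(x)` is trace class for `ν_ρ`-almost all `x`). -/
def MemPredual (ρ : State b) (g : X → (H →L[ℂ] H)) : Prop :=
  IsQuantumRandomVariable b g ∧ ∫⁻ x, traceNorm b (g x) ∂ν.inducedMeasure ρ < ∞

/-- The duality pairing `∫ tr(g(x) f(x)) dν_ρ(x)` of the predual with `L^∞_H(X, ν)`. -/
def pairing (ρ : State b) (g : X → (H →L[ℂ] H)) : ν.Linfty → ℂ :=
  Quotient.lift (s := Submodule.quotientRel ν.nullFunctions)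
    (fun f => ∫ x, trace b (g x * f.1 x) ∂ν.inducedMeasure ρ)
    (fun f f' h => integral_congr_ae <| by
      filter_upwards [(ae_eq_of_rel h).filter_mono (ν.ae_inducedMeasure_le ρ)] with x hx
      simp only [hx])

/-- The weak* topology on `L^∞_H(X, ν)`: the coarsest topology for which the pairing with every
element of the predual is continuous. -/
@[reducible] def weakStar (ρ : State b) : TopologicalSpace ν.Linfty :=
  ⨅ g : {g : X → (H →L[ℂ] H) // ν.MemPredual ρ g},
    TopologicalSpace.induced (ν.pairing ρ g.1) inferInstance

/-! ### The Radon–Nikodým derivative and the quantum expected value -/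

/-- `D` is (a version of) the Radon–Nikodým derivative `dν/dν_ρ`: a quantum random variable, with
bounded operators as values, whose matrix entries in the basis `eᵢ` are the classical
Radon–Nikodým derivatives of the complex measures `ν_ij(E) = ⟨ν(E) eⱼ, eᵢ⟩` with respect to
`ν_ρ`. -/
structure IsRNDeriv (ρ : State b) (D : X → (H →L[ℂ] H)) : Prop where
  isQuantumRandomVariable : IsQuantumRandomVariable b D
  integrable : ∀ i j, Integrable (fun x => inner ℂ (b i) (D x (b j))) (ν.inducedMeasure ρ)
  setIntegral_eq : ∀ i j, ∀ E, MeasurableSet E →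
    ∫ x in E, inner ℂ (b i) (D x (b j)) ∂ν.inducedMeasure ρ = inner ℂ (b i) (ν.toFun E (b j))

end POVM

/-- The function `f_s(x) = tr(s D(x)^{1/2} f(x) D(x)^{1/2})`. -/
def scalarDensity {b : HilbertBasis ι ℂ H} (D f : X → (H →L[ℂ] H)) (s : State b) (x : X) : ℂ :=
  trace b (s.op * CFC.sqrt (D x) * f x * CFC.sqrt (D x))

namespace POVM

variable {b : HilbertBasis ι ℂ H} (ν : POVM X b)

/-- `ν`-integrability of a positive quantum random variable: `f_s` is `ν_ρ`-integrable for every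
state `s`. -/
def IntegrablePos (ρ : State b) (D f : X → (H →L[ℂ] H)) : Prop :=
  ∀ s : State b, Integrable (scalarDensity D f s) (ν.inducedMeasure ρ)

/-- `ν`-integrability of a quantum random variable: the positive and negative parts of its real
and imaginary parts are `ν`-integrable. -/
def QIntegrable (ρ : State b) (D f : X → (H →L[ℂ] H)) : Prop :=
  ν.IntegrablePos ρ D (fun x => (ℜ (f x) : H →L[ℂ] H)⁺) ∧
  ν.IntegrablePos ρ D (fun x => (ℜ (f x) : H →L[ℂ] H)⁻) ∧
  ν.IntegrablePos ρ D (fun x => (ℑ (f x) : H →L[ℂ] H)⁺) ∧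
  ν.IntegrablePos ρ D (fun x => (ℑ (f x) : H →L[ℂ] H)⁻)

/-- `f` is `ν`-integrable and the operator `A` is its integral `∫ f dν`, that is,
`tr(s A) = ∫ f_s dν_ρ` for every state `s`. -/
def HasQIntegral (ρ : State b) (D f : X → (H →L[ℂ] H)) (A : H →L[ℂ] H) : Prop :=
  ν.QIntegrable ρ D f ∧
    ∀ s : State b, trace b (s.op * A) = ∫ x, scalarDensity D f s x ∂ν.inducedMeasure ρ

open Classical in
/-- The integral `∫ f dν` of a quantum random variable (zero if it does not exist). -/
def qIntegral (ρ : State b) (D f : X → (H →L[ℂ] H)) : H →L[ℂ] H :=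
  if h : ∃ A, ν.HasQIntegral ρ D f A then h.choose else 0

variable {ν} in
lemma IntegrablePos.congr {ρ : State b} {D f g : X → (H →L[ℂ] H)} (hf : ν.IntegrablePos ρ D f)
    (h : f =ᵐ[ν.inducedMeasure ρ] g) : ν.IntegrablePos ρ D g := fun s => by
  refine (hf s).congr ?_
  filter_upwards [h] with x hx
  simp only [scalarDensity, hx]

variable {ν} in
lemma HasQIntegral.congr {ρ : State b} {D f g : X → (H →L[ℂ] H)} {A : H →L[ℂ] H}
    (hf : ν.HasQIntegral ρ D f A) (h : f =ᵐ[ν.inducedMeasure ρ] g) : ν.HasQIntegral ρ D g A := by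
  obtain ⟨⟨h1, h2, h3, h4⟩, h5⟩ := hf
  refine ⟨⟨h1.congr ?_, h2.congr ?_, h3.congr ?_, h4.congr ?_⟩, fun s => ?_⟩
  any_goals
    filter_upwards [h] with x hx
    simp only [hx]
  rw [h5 s]
  refine integral_congr_ae ?_
  filter_upwards [h] with x hx
  simp only [scalarDensity, hx]

/-- The quantum expected value map `E_ν(f) = ∫ f dν` on `L^∞_H(X, ν)`. -/
def expectation (ρ : State b) (D : X → (H →L[ℂ] H)) : ν.Linfty → (H →L[ℂ] H) :=
  Quotient.lift (s := Submodule.quotientRel ν.nullFunctions)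
    (fun f => ν.qIntegral ρ D f.1)
    (fun f f' h => by
      have he := (ae_eq_of_rel h).filter_mono (ν.ae_inducedMeasure_le ρ)
      have hp : ν.HasQIntegral ρ D f.1 = ν.HasQIntegral ρ D f'.1 := by
        ext A
        exact ⟨fun hA => hA.congr he, fun hA => hA.congr he.symm⟩
      unfold qIntegral
      rw [hp])

end POVM

end QuantumExpectation

end

open QuantumExpectation

open MeasureTheory Filter Topology ComplexStarModule
open scoped ENNReal

namespace QuantumExpectation

variable {H : Type*} [NormedAddCommGroup H] [InnerProductSpace ℂ H] [CompleteSpace H]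
variable {ι : Type*}

/-! ### Hilbert–Schmidt operators -/

/-! The map `E_ν` is a Banach space adjoint: `tr(t E_ν(f)) = ∫ tr(D^{1/2} t D^{1/2} f) dν_ρ`, the
pairing of `f` with the image of `t` under the preadjoint `t ↦ D^{1/2} t D^{1/2}`. Once this map is
known to land in the predual, each functional defining the ultraweak topology pulls back to one
defining the weak* topology, which is continuity.

The analytic core is `lintegral_norm_sqrt_sq_le`: `∫ ‖D^{1/2} v‖² dν_ρ ≤ ‖ν(X)‖ ‖v‖²`. It makes the
form `∫ ⟨D^{1/2} u, f D^{1/2} v⟩ dν_ρ` bounded, so an operator represents it (`exists_operator`).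
Summed over `v = s^{1/2} e_i` for a state `s`, it gives an integrable function
(`integrable_tsum_norm_sqrt_sq`) that dominates `f_s` and, up to a constant, the trace norm of
`D^{1/2} s D^{1/2}`.

General trace class operators reduce to states by polar decomposition and polarization
(`IsTraceClass.exists_eq_sum_state`). The cyclicity of the trace that is needed involves only pairs
of Hilbert–Schmidt operators. Measurability goes through matrix elements: separability makes the
basis countable, and the functional calculus is a limit of polynomials. -/

/-- `S` is a Hilbert–Schmidt operator. -/
def IsHilbertSchmidt (b : HilbertBasis ι ℂ H) (S : H →L[ℂ] H) : Prop :=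
  Summable fun i => ‖S (b i)‖ ^ 2

lemma mul_le_sq_add_sq (u v : ℝ) : u * v ≤ u ^ 2 + v ^ 2 := by
  nlinarith [sq_nonneg (u - v), sq_nonneg u, sq_nonneg v]

/-- The double series of `⟨B e_i, e_j⟩⟨e_j, C e_i⟩` converges absolutely, so it may be summed in
either order. The two orders give `tr(B* C) = tr(C B*)`, the only form of cyclicity needed. -/
lemma IsHilbertSchmidt.hasSum_inner {b : HilbertBasis ι ℂ H} {B C : H →L[ℂ] H}
    (hB : IsHilbertSchmidt b B) (hC : IsHilbertSchmidt b C) :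
    HasSum (fun i => inner ℂ (B (b i)) (C (b i))) (trace b (star B * C)) ∧
    HasSum (fun i => inner ℂ (star C (b i)) (star B (b i))) (trace b (star B * C)) := by
  let F : ι × ι → ℂ := fun p => inner ℂ (B (b p.1)) (b p.2) * inner ℂ (b p.2) (C (b p.1))
  have hF : Summable F := by
    refine Summable.of_norm_bounded
      ((summable_prod_norm_sq hB).add (summable_prod_norm_sq hC)) fun p => ?_
    rw [norm_mul, norm_inner_symm]
    exact mul_le_sq_add_sq _ _
  have ha : ∀ i, HasSum (fun j => F (i, j)) (inner ℂ (B (b i)) (C (b i))) := fun i =>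
    b.hasSum_inner_mul_inner (B (b i)) (C (b i))
  have hb : ∀ j, HasSum (fun i => F (i, j)) (inner ℂ (star C (b j)) (star B (b j))) := by
    intro j
    have h := b.hasSum_inner_mul_inner (star C (b j)) (star B (b j))
    have e : ∀ i, F (i, j) = inner ℂ (star C (b j)) (b i) * inner ℂ (b i) (star B (b j)) := by
      intro i
      rw [ContinuousLinearMap.star_eq_adjoint, ContinuousLinearMap.star_eq_adjoint,
        ContinuousLinearMap.adjoint_inner_left, ContinuousLinearMap.adjoint_inner_right]
      exact mul_comm _ _
    simpa only [e] using h
  have h1 := hF.hasSum.prod_fiberwise ha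
  have h2 := ((Equiv.prodComm ι ι).hasSum_iff.mpr hF.hasSum).prod_fiberwise hb
  have h3 : trace b (star B * C) = ∑' p, F p := by
    rw [← h1.tsum_eq, trace]
    simp only [mul_apply_eq_comp, ContinuousLinearMap.star_eq_adjoint,
      ContinuousLinearMap.adjoint_inner_right]
  rw [h3]
  exact ⟨h1, h2⟩

lemma IsHilbertSchmidt.star {b : HilbertBasis ι ℂ H} {S : H →L[ℂ] H}
    (hS : IsHilbertSchmidt b S) : IsHilbertSchmidt b (star S) ∧
      ∑' i, ‖star S (b i)‖ ^ 2 = ∑' i, ‖S (b i)‖ ^ 2 := by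
  obtain ⟨h1, h2⟩ := hS.hasSum_inner hS
  have e : ∀ x : H, (inner ℂ x x).re = ‖x‖ ^ 2 := fun x => by
    rw [inner_self_eq_norm_sq_to_K]; norm_cast
  replace h1 := Complex.hasSum_re h1
  replace h2 := Complex.hasSum_re h2
  simp only [e] at h1 h2
  exact ⟨h2.summable, h2.tsum_eq.trans h1.tsum_eq.symm⟩

set_option linter.unusedSectionVars false in
lemma IsHilbertSchmidt.mul_left {b : HilbertBasis ι ℂ H} {S : H →L[ℂ] H}
    (hS : IsHilbertSchmidt b S) (A : H →L[ℂ] H) : IsHilbertSchmidt b (A * S) := by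
  refine Summable.of_nonneg_of_le (fun i => sq_nonneg _) (fun i => ?_)
    (Summable.mul_left (‖A‖ ^ 2) hS)
  rw [← mul_pow]
  exact pow_le_pow_left₀ (norm_nonneg _) (A.le_opNorm _) 2

lemma IsHilbertSchmidt.mul_right {b : HilbertBasis ι ℂ H} {S : H →L[ℂ] H}
    (hS : IsHilbertSchmidt b S) (A : H →L[ℂ] H) : IsHilbertSchmidt b (S * A) := by
  have h := (hS.star.1.mul_left (Star.star A)).star.1
  rwa [star_mul, star_star, star_star] at h

/-- `W` moves the basis, so no termwise comparison is possible; after taking adjoints, `W*` acts on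
the left and contracts each term. -/
lemma IsHilbertSchmidt.tsum_mul_right_le {b : HilbertBasis ι ℂ H} {S : H →L[ℂ] H}
    (hS : IsHilbertSchmidt b S) {W : H →L[ℂ] H} (hW : ‖W‖ ≤ 1) :
    ∑' i, ‖(S * W) (b i)‖ ^ 2 ≤ ∑' i, ‖S (b i)‖ ^ 2 := by
  rw [← (hS.mul_right W).star.2, ← hS.star.2]
  refine Summable.tsum_le_tsum (fun i => ?_) (hS.mul_right W).star.1 hS.star.1
  rw [star_mul]
  refine pow_le_pow_left₀ (norm_nonneg _) ?_ 2
  refine ((Star.star W).le_opNorm _).trans ?_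
  rw [norm_star]
  exact mul_le_of_le_one_left (norm_nonneg _) hW

set_option linter.unusedSectionVars false in
lemma IsHilbertSchmidt.add {b : HilbertBasis ι ℂ H} {S T : H →L[ℂ] H}
    (hS : IsHilbertSchmidt b S) (hT : IsHilbertSchmidt b T) : IsHilbertSchmidt b (S + T) := by
  refine Summable.of_nonneg_of_le (fun i => sq_nonneg _) (fun i => ?_)
    (Summable.mul_left 2 (Summable.add hS hT))
  have h := norm_add_le (S (b i)) (T (b i))
  rw [add_apply]
  nlinarith [sq_nonneg (‖S (b i)‖ - ‖T (b i)‖), norm_nonneg (S (b i) + T (b i))]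

lemma IsHilbertSchmidt.smul {b : HilbertBasis ι ℂ H} {S : H →L[ℂ] H}
    (hS : IsHilbertSchmidt b S) (c : ℂ) : IsHilbertSchmidt b (c • S) := by
  have h := hS.mul_left (c • 1)
  rwa [smul_mul_assoc, one_mul] at h

lemma IsHilbertSchmidt.isTraceClass {b : HilbertBasis ι ℂ H} {S : H →L[ℂ] H}
    (hS : IsHilbertSchmidt b S) : IsTraceClass b (Star.star S * S) := by
  have e : ∀ x : H, (inner ℂ x ((Star.star S * S) x)).re = ‖S x‖ ^ 2 := fun x => by
    rw [mul_apply_eq_comp, ContinuousLinearMap.star_eq_adjoint,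
      ContinuousLinearMap.adjoint_inner_right, inner_self_eq_norm_sq_to_K]
    norm_cast
  unfold IsTraceClass traceNorm
  rw [CFC.abs_of_nonneg _ (star_mul_self_nonneg S)]
  simp only [e]
  rw [← ENNReal.ofReal_tsum_of_nonneg (fun i => by positivity) hS]
  exact ENNReal.ofReal_lt_top

/-! ### Polar decomposition -/

lemma inner_abs_apply (T : H →L[ℂ] H) (x y : H) :
    inner ℂ (CFC.abs T x) (CFC.abs T y) = inner ℂ (T x) (T y) := by
  have h : IsSelfAdjoint (CFC.abs T) := IsSelfAdjoint.of_nonneg (CFC.abs_nonneg T)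
  rw [← ContinuousLinearMap.adjoint_inner_right, h.adjoint_eq, ← mul_apply_eq_comp,
    CFC.abs_mul_abs, mul_apply_eq_comp, ContinuousLinearMap.star_eq_adjoint,
    ContinuousLinearMap.adjoint_inner_right]

/-- Polar decomposition. -/
lemma exists_polar (T : H →L[ℂ] H) : ∃ W : H →L[ℂ] H, ‖W‖ ≤ 1 ∧ W * CFC.abs T = T ∧
    star W * T = CFC.abs T := by
  set K := (LinearMap.range (CFC.abs T).toLinearMap).topologicalClosure with hK
  have hmem : ∀ x, CFC.abs T x ∈ K := fun x =>
    Submodule.le_topologicalClosure _ ⟨x, rfl⟩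
  let e : H →ₗ[ℂ] K := (CFC.abs T).toLinearMap.codRestrict K hmem
  have hdense : DenseRange e := by
    intro k
    rw [Metric.mem_closure_iff]
    intro ε hε
    obtain ⟨_, ⟨x, rfl⟩, hx⟩ := Metric.mem_closure_iff.1 k.2 ε hε
    exact ⟨e x, ⟨x, rfl⟩, hx⟩
  have hn : ∀ x, ‖T x‖ ≤ 1 * ‖e x‖ := fun x => by
    have h := inner_abs_apply T x x
    rw [inner_self_eq_norm_sq_to_K, inner_self_eq_norm_sq_to_K] at h
    have h2 : ‖CFC.abs T x‖ ^ 2 = ‖T x‖ ^ 2 := by exact_mod_cast h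
    have h3 := (sq_eq_sq₀ (norm_nonneg _) (norm_nonneg _)).1 h2
    rw [one_mul, ← h3]
    rfl
  have : CompleteSpace K := (Submodule.isClosed_topologicalClosure _).completeSpace_coe
  -- Since `‖T x‖ = ‖|T| x‖`, the assignment `|T| x ↦ T x` is isometric on the range of `|T|` and
  -- extends to its closure `K`; `W` is this extension after the projection onto `K`.
  let V : K →L[ℂ] H := T.toLinearMap.extendOfNorm e
  have hV : ∀ x, V (e x) = T x := fun x => LinearMap.extendOfNorm_eq hdense ⟨1, hn⟩ x
  have hW : ∀ x, (V ∘L K.orthogonalProjectionOnto) (CFC.abs T x) = T x := fun x => by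
    rw [← hV x]
    simp only [ContinuousLinearMap.comp_apply]
    congr 1
    exact K.orthogonalProjectionOnto_mem_subspace_eq_self (e x)
  refine ⟨V ∘L K.orthogonalProjectionOnto, ?_, ?_, ?_⟩
  · refine (ContinuousLinearMap.opNorm_comp_le _ _).trans ?_
    have h1 : ‖V‖ ≤ 1 := LinearMap.opNorm_extendOfNorm_le hdense zero_le_one hn
    exact mul_le_one₀ h1 (norm_nonneg _) K.orthogonalProjectionOnto_norm_le
  · ext x
    exact hW x
  · ext x
    refine ext_inner_right ℂ fun y => ?_
    rw [mul_apply_eq_comp, ContinuousLinearMap.star_eq_adjoint,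
      ContinuousLinearMap.adjoint_inner_left, ContinuousLinearMap.comp_apply]
    have h1 : inner ℂ (CFC.abs T x) y
        = inner ℂ (CFC.abs T x) (K.orthogonalProjectionOnto y : H) :=
      (Submodule.inner_orthogonalProjectionOnto_eq_of_mem_left ⟨_, hmem x⟩ y).symm
    rw [h1]
    refine hdense.induction_on (p := fun k : K => inner ℂ (T x) (V k)
      = inner ℂ (CFC.abs T x) (k : H)) _ ?_ fun z => ?_
    · exact isClosed_eq (by fun_prop) (by fun_prop)
    · rw [hV, ← inner_abs_apply]
      rfl

/-! ### Decomposition of trace class operators -/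

lemma IsTraceClass.isHilbertSchmidt_sqrt_abs {b : HilbertBasis ι ℂ H} {T : H →L[ℂ] H}
    (hT : IsTraceClass b T) : IsHilbertSchmidt b (CFC.sqrt (CFC.abs T)) := by
  refine summable_sqrt (CFC.abs_nonneg T) ?_
  unfold IsTraceClass traceNorm at hT ⊢
  rwa [CFC.abs_of_nonneg _ (CFC.abs_nonneg T)]

lemma exists_state_smul {b : HilbertBasis ι ℂ H} (ρ : State b) {S : H →L[ℂ] H}
    (hS : IsHilbertSchmidt b S) : ∃ (c : ℂ) (s : State b), star S * S = c • s.op := by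
  obtain ⟨r, hr⟩ : ∃ r, r = ∑' i, ‖S (b i)‖ ^ 2 := ⟨_, rfl⟩
  by_cases h0 : r = 0
  -- Here `S = 0` cannot be normalized; the coefficient is `0`, and `ρ` merely supplies some state.
  · have h1 : HasSum (fun i => ‖S (b i)‖ ^ 2) 0 := by rw [← h0, hr]; exact hS.hasSum
    rw [hasSum_zero_iff_of_nonneg (fun i => sq_nonneg _)] at h1
    have h2 : S = 0 := by
      refine ContinuousLinearMap.ext_on
        (Submodule.dense_iff_topologicalClosure_eq_top.2 b.dense_span) ?_
      rintro _ ⟨i, rfl⟩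
      simpa using congrFun h1 i
    exact ⟨0, ρ, by simp [h2]⟩
  · have hrn : 0 ≤ r := hr ▸ tsum_nonneg fun i => sq_nonneg _
    let c : ℂ := ((Real.sqrt r)⁻¹ : ℝ)
    have hc : star c * c = ((r⁻¹ : ℝ) : ℂ) := by
      simp only [c, RCLike.star_def, Complex.conj_ofReal, ← Complex.ofReal_mul]
      rw [← mul_inv, Real.mul_self_sqrt hrn]
    have hop : star (c • S) * (c • S) = ((r⁻¹ : ℝ) : ℂ) • (star S * S) := by
      rw [star_smul, smul_mul_smul_comm, hc]
    refine ⟨(r : ℂ), ⟨star (c • S) * (c • S), star_mul_self_nonneg _, (hS.smul c).isTraceClass, ?_⟩,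
      ?_⟩
    · have h := (hS.hasSum_inner hS).1
      simp only [inner_self_eq_norm_sq_to_K] at h
      have h' : trace b (star S * S) = (r : ℂ) := by
        rw [← h.tsum_eq, hr, Complex.ofReal_tsum]
        simp
      rw [hop, trace]
      simp only [smul_apply, inner_smul_right, tsum_mul_left]
      rw [← trace, h', ← Complex.ofReal_mul, inv_mul_cancel₀ h0, Complex.ofReal_one]
    · change _ = (r : ℂ) • (star (c • S) * (c • S))
      rw [hop, smul_smul, ← Complex.ofReal_mul, mul_inv_cancel₀ h0, Complex.ofReal_one, one_smul]

/-- With `B = |T|^{1/2}` and `A = W B`, polar decomposition gives `T = A B`. Polarization over the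
fourth roots of unity gives `A B = ¼ ∑ i^k (B + i^k A*)* (B + i^k A*)`, and each summand is a
multiple of a state. -/
lemma IsTraceClass.exists_eq_sum_state {b : HilbertBasis ι ℂ H} (ρ : State b) {T : H →L[ℂ] H}
    (hT : IsTraceClass b T) :
    ∃ (c : Fin 4 → ℂ) (s : Fin 4 → State b), T = ∑ k, c k • (s k).op := by
  obtain ⟨W, -, hW, -⟩ := exists_polar T
  have hB := hT.isHilbertSchmidt_sqrt_abs
  obtain ⟨B, hBe⟩ : ∃ B, B = CFC.sqrt (CFC.abs T) := ⟨_, rfl⟩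
  have hs : star B = B := by
    rw [hBe]
    exact IsSelfAdjoint.of_nonneg (CFC.sqrt_nonneg _)
  have hBB : B * B = CFC.abs T := by rw [hBe, CFC.sqrt_mul_sqrt_self _ (CFC.abs_nonneg T)]
  rw [← hBe] at hB
  have hQ : ∀ k : Fin 4, IsHilbertSchmidt b (B + Complex.I ^ (k : ℕ) • star (W * B)) := fun k =>
    hB.add ((hB.mul_left W).star.1.smul _)
  choose c s h using fun k => exists_state_smul ρ (hQ k)
  refine ⟨fun k => (4 : ℂ)⁻¹ * Complex.I ^ (k : ℕ) * c k, s, ?_⟩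
  simp only [mul_smul, ← h]
  rw [Fin.sum_univ_four]
  have hT' : T = W * B * B := by rw [mul_assoc, hBB, hW]
  rw [hT']
  generalize W * B = A
  simp only [star_add, star_smul, star_star, hs, add_mul, mul_add, smul_mul_assoc, mul_smul_comm]
  simp [pow_succ]
  match_scalars <;> ring_nf <;> norm_num [Complex.I_sq]

/-- Writing `|T| = W* T` turns the diagonal entries of `|T|` into `∑ c_k ⟨Q_k W e_i, Q_k e_i⟩`. The
factor `2` comes from `uv ≤ u² + v²` and the fact that a contraction does not increase the
Hilbert–Schmidt norm. -/
lemma traceNorm_sum_le {b : HilbertBasis ι ℂ H} {κ : Type*} [Fintype κ] (c : κ → ℂ)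
    {Q : κ → H →L[ℂ] H} (hQ : ∀ k, IsHilbertSchmidt b (Q k)) :
    traceNorm b (∑ k, c k • (star (Q k) * Q k)) ≤
      ENNReal.ofReal (∑ k, ‖c k‖ * (2 * ∑' i, ‖Q k (b i)‖ ^ 2)) := by
  obtain ⟨W, hW1, -, hW⟩ := exists_polar (∑ k, c k • (star (Q k) * Q k))
  have hs : HasSum (fun i => ∑ k, ‖c k‖ * (‖(Q k * W) (b i)‖ ^ 2 + ‖Q k (b i)‖ ^ 2))
      (∑ k, ‖c k‖ * (∑' i, ‖(Q k * W) (b i)‖ ^ 2 + ∑' i, ‖Q k (b i)‖ ^ 2)) :=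
    hasSum_sum fun k _ => (((hQ k).mul_right W).hasSum.add (hQ k).hasSum).mul_left _
  have hle : ∀ i, (inner ℂ (b i) (CFC.abs (∑ k, c k • (star (Q k) * Q k)) (b i))).re ≤
      ∑ k, ‖c k‖ * (‖(Q k * W) (b i)‖ ^ 2 + ‖Q k (b i)‖ ^ 2) := by
    intro i
    rw [← hW, mul_apply_eq_comp, ContinuousLinearMap.star_eq_adjoint,
      ContinuousLinearMap.adjoint_inner_right, sum_apply, inner_sum, Complex.re_sum]
    refine Finset.sum_le_sum fun k _ => ?_
    refine (Complex.re_le_norm _).trans ?_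
    rw [smul_apply, inner_smul_right, norm_mul, mul_apply_eq_comp,
      ContinuousLinearMap.star_eq_adjoint, ContinuousLinearMap.adjoint_inner_right]
    gcongr
    exact (norm_inner_le_norm _ _).trans (mul_le_sq_add_sq _ _)
  calc traceNorm b (∑ k, c k • (star (Q k) * Q k))
      ≤ ∑' i, ENNReal.ofReal (∑ k, ‖c k‖ * (‖(Q k * W) (b i)‖ ^ 2 + ‖Q k (b i)‖ ^ 2)) :=
        ENNReal.tsum_le_tsum fun i => ENNReal.ofReal_le_ofReal (hle i)
    _ = ENNReal.ofReal _ := by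
        rw [← ENNReal.ofReal_tsum_of_nonneg (fun i => by positivity) hs.summable, hs.tsum_eq]
    _ ≤ _ := by
        refine ENNReal.ofReal_le_ofReal (Finset.sum_le_sum fun k _ => ?_)
        gcongr
        rw [two_mul]
        exact add_le_add_left ((hQ k).tsum_mul_right_le hW1) _

end QuantumExpectation

namespace QuantumExpectation

variable {H : Type*} [NormedAddCommGroup H] [InnerProductSpace ℂ H]
variable {ι : Type*} {X : Type*} [MeasurableSpace X]

/-! ### Weak measurability -/

/-- Distinct basis vectors are at distance `√2`, so no point of a dense sequence lies within `1/2`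
of two of them. -/
lemma countable_of_hilbertBasis [TopologicalSpace.SeparableSpace H] (b : HilbertBasis ι ℂ H) :
    Countable ι := by
  have hex : ∀ i, ∃ n, dist (b i) (TopologicalSpace.denseSeq H n) < 1 / 2 := fun i =>
    (TopologicalSpace.denseRange_denseSeq H).exists_dist_lt (b i) (by norm_num)
  choose n hn using hex
  refine Function.Injective.countable (f := n) fun i j hij => ?_
  by_contra hne
  have h1 : dist (b i) (b j) < 1 := by
    have := dist_triangle_right (b i) (b j) (TopologicalSpace.denseSeq H (n i))
    have h2 := hn j
    rw [← hij] at h2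
    linarith [hn i]
  have h3 := norm_sub_sq (𝕜 := ℂ) (b i) (b j)
  rw [b.orthonormal.2 hne, b.orthonormal.1, b.orthonormal.1, ← dist_eq_norm] at h3
  simp only [map_zero] at h3
  nlinarith [dist_nonneg (x := b i) (y := b j)]

/-- The matrix elements `⟨u, F(x) v⟩` are measurable. -/
def WeaklyMeasurable (F : X → (H →L[ℂ] H)) : Prop :=
  ∀ u v, Measurable fun x => inner ℂ u (F x v)

lemma measurable_of_hasSum [Countable ι] {E : Type*} [NormedAddCommGroup E]
    [SecondCountableTopology E] [MeasurableSpace E] [BorelSpace E] {f : ι → X → E} {g : X → E}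
    (hf : ∀ i, Measurable (f i)) (h : ∀ x, HasSum (fun i => f i x) (g x)) : Measurable g := by
  refine measurable_of_tendsto_metrizable' (f := fun (t : Finset ι) x => ∑ i ∈ t, f i x) atTop
    (fun t => Finset.measurable_fun_sum _ fun i _ => hf i) ?_
  rw [tendsto_pi_nhds]
  intro x
  simpa [HasSum] using h x

namespace WeaklyMeasurable

lemma const (A : H →L[ℂ] H) : WeaklyMeasurable fun _ : X => A := fun _ _ => measurable_const

lemma add {F G : X → (H →L[ℂ] H)} (hF : WeaklyMeasurable F) (hG : WeaklyMeasurable G) :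
    WeaklyMeasurable fun x => F x + G x := fun u v => by
  simp only [add_apply, inner_add_right]
  exact (hF u v).add (hG u v)

lemma smul {F : X → (H →L[ℂ] H)} (hF : WeaklyMeasurable F) (c : ℂ) :
    WeaklyMeasurable fun x => c • F x := fun u v => by
  simp only [smul_apply, inner_smul_right]
  exact (hF u v).const_mul c

lemma real_smul {F : X → (H →L[ℂ] H)} (hF : WeaklyMeasurable F) (c : ℝ) :
    WeaklyMeasurable fun x => c • F x := by
  simpa only [Complex.coe_smul] using hF.smul (c : ℂ)

lemma of_tendsto {F : ℕ → X → (H →L[ℂ] H)} {G : X → (H →L[ℂ] H)}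
    (hF : ∀ n, WeaklyMeasurable (F n)) (h : ∀ x, Tendsto (fun n => F n x) atTop (𝓝 (G x))) :
    WeaklyMeasurable G := fun u v => by
  refine measurable_of_tendsto_metrizable (fun n => hF n u v) ?_
  rw [tendsto_pi_nhds]
  intro x
  have hc : Continuous fun A : H →L[ℂ] H => inner ℂ u (A v) := by fun_prop
  exact (hc.tendsto _).comp (h x)

lemma ite {F : X → (H →L[ℂ] H)} (hF : WeaklyMeasurable F) {p : X → Prop} [DecidablePred p]
    (hp : MeasurableSet {x | p x}) : WeaklyMeasurable fun x => if p x then F x else 0 :=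
  fun u v => by
  have h : (fun x => inner ℂ u ((if p x then F x else 0) v)) =
      fun x => if p x then inner ℂ u (F x v) else 0 := by
    ext x
    split_ifs <;> simp
  rw [h]
  exact Measurable.ite hp (hF u v) measurable_const

variable [CompleteSpace H]

lemma star {F : X → (H →L[ℂ] H)} (hF : WeaklyMeasurable F) :
    WeaklyMeasurable fun x => star (F x) := fun u v => by
  simp only [ContinuousLinearMap.star_eq_adjoint, ContinuousLinearMap.adjoint_inner_right]
  simp only [← inner_conj_symm _ v]
  exact Complex.continuous_conj.measurable.comp (hF v u)

variable [TopologicalSpace.SeparableSpace H]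

lemma mul (b : HilbertBasis ι ℂ H) {F G : X → (H →L[ℂ] H)} (hF : WeaklyMeasurable F)
    (hG : WeaklyMeasurable G) : WeaklyMeasurable fun x => F x * G x := fun u v => by
  have := countable_of_hilbertBasis b
  refine measurable_of_hasSum (f := fun i x => inner ℂ u (F x (b i)) * inner ℂ (b i) (G x v))
    (fun i => (hF u (b i)).mul (hG (b i) v)) fun x => ?_
  have h := b.hasSum_inner_mul_inner (ContinuousLinearMap.adjoint (F x) u) (G x v)
  simp only [ContinuousLinearMap.adjoint_inner_left] at h
  exact h

lemma aeval (b : HilbertBasis ι ℂ H) {F : X → (H →L[ℂ] H)} (hF : WeaklyMeasurable F)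
    (p : Polynomial ℝ) : WeaklyMeasurable fun x => Polynomial.aeval (F x) p := by
  induction p using Polynomial.induction_on' with
  | add p q hp hq => simpa only [map_add] using hp.add hq
  | monomial n r =>
    have hpow : WeaklyMeasurable fun x => F x ^ n := by
      induction n with
      | zero => simpa using const 1
      | succ n ih => simpa only [pow_succ] using ih.mul b hF
    simp only [Polynomial.aeval_monomial, Algebra.algebraMap_eq_smul_one, smul_mul_assoc, one_mul]
    exact hpow.real_smul r

/-- By Weierstrass, pick a polynomial within `1/(n+1)` of `g` on `[-n, n]`, independently of `x`.
Once `n ≥ ‖F x‖` the interval contains the spectrum, so the polynomials in `F x` converge in norm.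
-/
lemma cfc (b : HilbertBasis ι ℂ H) {F : X → (H →L[ℂ] H)} (hF : WeaklyMeasurable F)
    (hs : ∀ x, IsSelfAdjoint (F x)) {g : ℝ → ℝ} (hg : Continuous g) :
    WeaklyMeasurable fun x => cfc g (F x) := by
  have hp : ∀ n : ℕ, ∃ p : Polynomial ℝ, ∀ t ∈ Set.Icc (-(n : ℝ)) n,
      |p.eval t - g t| < 1 / ((n : ℝ) + 1) := fun n =>
    exists_polynomial_near_of_continuousOn _ _ g hg.continuousOn _ Nat.one_div_pos_of_nat
  choose p hp using hp
  refine of_tendsto (fun n => hF.aeval b (p n)) fun x => ?_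
  rw [tendsto_iff_norm_sub_tendsto_zero]
  refine squeeze_zero' (Eventually.of_forall fun n => norm_nonneg _) ?_
    (tendsto_one_div_add_atTop_nhds_zero_nat (𝕜 := ℝ))
  filter_upwards [eventually_ge_atTop ⌈‖F x‖⌉₊] with n hn
  have hn' : ‖F x‖ ≤ n := Nat.ceil_le.1 hn
  rw [← cfc_polynomial (p n) (F x) (hs x),
    ← cfc_sub (p n).eval g (F x) (p n).continuous.continuousOn hg.continuousOn]
  refine norm_cfc_le (by positivity) fun t ht => ?_
  refine (hp n t ?_).le
  have h1 : ‖t‖ ≤ ‖F x‖ := by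
    refine (spectrum.norm_le_norm_mul_of_mem ht).trans ?_
    exact mul_le_of_le_one_right (norm_nonneg _) ContinuousLinearMap.norm_id_le
  exact abs_le.1 (h1.trans hn')

lemma posPart (b : HilbertBasis ι ℂ H) {F : X → (H →L[ℂ] H)} (hF : WeaklyMeasurable F)
    (hs : ∀ x, IsSelfAdjoint (F x)) : WeaklyMeasurable fun x => (F x)⁺ := by
  have h : ∀ x, (F x)⁺ = _root_.cfc (fun t : ℝ => t⁺) (F x) := fun x => by
    rw [CFC.posPart_def, cfcₙ_eq_cfc]
  simp only [h]
  exact hF.cfc b hs (by fun_prop)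

lemma negPart (b : HilbertBasis ι ℂ H) {F : X → (H →L[ℂ] H)} (hF : WeaklyMeasurable F)
    (hs : ∀ x, IsSelfAdjoint (F x)) : WeaklyMeasurable fun x => (F x)⁻ := by
  have e : ∀ x, (F x)⁻ = ((-1 : ℝ) • F x)⁺ := fun x => by
    rw [neg_smul, one_smul, CFC.posPart_neg]
  have hs' : ∀ x, IsSelfAdjoint ((-1 : ℝ) • F x) := fun x => by
    rw [neg_smul, one_smul]
    exact (hs x).neg
  simp only [e]
  exact (hF.real_smul (-1)).posPart b hs'

set_option linter.unusedSectionVars false in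
lemma realPart {F : X → (H →L[ℂ] H)} (hF : WeaklyMeasurable F) :
    WeaklyMeasurable fun x => (ℜ (F x) : H →L[ℂ] H) := by
  simp only [realPart_apply_coe]
  exact (hF.add hF.star).real_smul _

set_option linter.unusedSectionVars false in
lemma imaginaryPart {F : X → (H →L[ℂ] H)} (hF : WeaklyMeasurable F) :
    WeaklyMeasurable fun x => (ℑ (F x) : H →L[ℂ] H) := by
  have h : ∀ x, ℑ (F x) = ℜ ((-Complex.I) • F x) := fun x => by
    simp
  simp only [h]
  exact (hF.smul _).realPart

end WeaklyMeasurable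

/-! ### Positivity, square roots and quantum random variables -/

variable [CompleteSpace H]

set_option linter.unusedSectionVars false in
lemma nonneg_iff_inner {A : H →L[ℂ] H} :
    0 ≤ A ↔ ∀ v, 0 ≤ (inner ℂ v (A v)).re ∧ (inner ℂ v (A v)).im = 0 := by
  rw [ContinuousLinearMap.nonneg_iff_isPositive, ContinuousLinearMap.isPositive_iff_complex]
  refine forall_congr' fun v => ?_
  have e : inner ℂ (A v) v = (starRingEnd ℂ) (inner ℂ v (A v)) := (inner_conj_symm _ _).symm
  rw [e]
  generalize inner ℂ v (A v) = z
  simp [Complex.ext_iff, eq_comm, and_comm]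

lemma nonneg_iff_inner_of_denseRange {A : H →L[ℂ] H} {κ : Type*} {d : κ → H} (hd : DenseRange d) :
    0 ≤ A ↔ ∀ n, 0 ≤ (inner ℂ (d n) (A (d n))).re ∧ (inner ℂ (d n) (A (d n))).im = 0 := by
  rw [nonneg_iff_inner]
  refine ⟨fun h n => h _, fun h v => ?_⟩
  refine hd.induction_on (p := fun v => 0 ≤ (inner ℂ v (A v)).re ∧ (inner ℂ v (A v)).im = 0)
    v ?_ h
  have hc : Continuous fun v => inner ℂ v (A v) := by fun_prop
  exact (isClosed_le continuous_const (Complex.continuous_re.comp hc)).inter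
    (isClosed_eq (Complex.continuous_im.comp hc) continuous_const)

variable [TopologicalSpace.SeparableSpace H]

lemma WeaklyMeasurable.measurableSet_nonneg {F : X → (H →L[ℂ] H)} (hF : WeaklyMeasurable F) :
    MeasurableSet {x | 0 ≤ F x} := by
  simp only [nonneg_iff_inner_of_denseRange (TopologicalSpace.denseRange_denseSeq H)]
  refine measurableSet_setOfPred.2 (Measurable.forall fun n => Measurable.and ?_ ?_)
  · exact measurableSet_setOfPred.1 (measurableSet_le measurable_const
      (Complex.measurable_re.comp (hF _ _)))
  · exact measurableSet_setOfPred.1 (measurableSet_eq_fun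
      (Complex.measurable_im.comp (hF _ _)) measurable_const)

set_option linter.unusedSectionVars false in
lemma sqrt_eq_zero_of_not_nonneg {A : H →L[ℂ] H} (hA : ¬ 0 ≤ A) : CFC.sqrt A = 0 :=
  cfcₙ_apply_of_not_predicate A hA

lemma WeaklyMeasurable.sqrt (b : HilbertBasis ι ℂ H) {F : X → (H →L[ℂ] H)}
    (hF : WeaklyMeasurable F) : WeaklyMeasurable fun x => CFC.sqrt (F x) := by
  classical
  -- `CFC.sqrt` is `0` off the positive operators, so cutting `F` to `0` on a measurable set makes
  -- it self-adjoint without changing the root.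
  have h : ∀ x, CFC.sqrt (F x) = _root_.cfc Real.sqrt (if 0 ≤ F x then F x else 0) := by
    intro x
    split_ifs with hx
    · rw [CFC.sqrt_eq_real_sqrt _ hx, cfcₙ_eq_cfc]
    · rw [sqrt_eq_zero_of_not_nonneg hx]
      simp
  simp only [h]
  refine (hF.ite hF.measurableSet_nonneg).cfc b (fun x => ?_) Real.continuous_sqrt
  split_ifs with hx
  · exact IsSelfAdjoint.of_nonneg hx
  · exact IsSelfAdjoint.zero _

/-- Pure states yield the diagonal elements and polarization the others; conversely, `tr(s F)` is
the countable sum of the diagonal elements of `F` at the vectors `s^{1/2} e_i`. -/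
lemma isQuantumRandomVariable_iff (b : HilbertBasis ι ℂ H) {F : X → (H →L[ℂ] H)} :
    IsQuantumRandomVariable b F ↔ WeaklyMeasurable F := by
  constructor
  · intro h
    have h1 : ∀ v, Measurable fun x => inner ℂ (F x v) v := by
      intro v
      by_cases hv : v = 0
      · simp [hv]
      have hn : ‖v‖ ≠ 0 := norm_ne_zero_iff.mpr hv
      have hu : ‖((‖v‖⁻¹ : ℝ) : ℂ) • v‖ = 1 := by
        rw [norm_smul]
        simp [hn]
      have h2 := h (pureState b _ hu)
      simp only [trace_pureState] at h2
      have h3 := Complex.continuous_conj.measurable.comp (h2.const_mul ((‖v‖ : ℂ) ^ 2))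
      convert h3 using 2 with x
      have hn' : (‖v‖ : ℂ) ≠ 0 := by exact_mod_cast hn
      simp only [Function.comp, map_smul, inner_smul_left, inner_smul_right, map_mul,
        inner_conj_symm, Complex.conj_ofReal, map_pow]
      push_cast
      field_simp
    intro u v
    have h2 : Measurable fun x => inner ℂ (F x v) u := by
      have e : ∀ x, inner ℂ (F x v) u = _ := fun x =>
        inner_map_polarization (F x : H →ₗ[ℂ] H) u v
      simp only [e]
      exact ((((h1 _).sub (h1 _)).add ((h1 _).const_mul _)).sub ((h1 _).const_mul _)).div_const _
    simp only [← inner_conj_symm u]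
    exact Complex.continuous_conj.measurable.comp h2
  · intro h s
    have := countable_of_hilbertBasis b
    exact measurable_of_hasSum (fun i => h _ _) fun x =>
      (hasSum_trace_mul s.nonneg s.isTraceClass (F x)).2

end QuantumExpectation

namespace QuantumExpectation

variable {H : Type*} [NormedAddCommGroup H] [InnerProductSpace ℂ H] [CompleteSpace H]
variable {ι : Type*} {X : Type*} [MeasurableSpace X]
variable {b : HilbertBasis ι ℂ H} {ν : POVM X b} {ρ : State b} {D : X → (H →L[ℂ] H)}

/-! ### The Radon–Nikodým derivative -/

lemma isSelfAdjoint_sqrt (A : H →L[ℂ] H) : IsSelfAdjoint (CFC.sqrt A) :=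
  IsSelfAdjoint.of_nonneg (CFC.sqrt_nonneg A)

lemma inner_sqrt_left (A : H →L[ℂ] H) (x y : H) :
    inner ℂ (CFC.sqrt A x) y = inner ℂ x (CFC.sqrt A y) := by
  rw [← ContinuousLinearMap.adjoint_inner_right, (isSelfAdjoint_sqrt A).adjoint_eq]

lemma norm_sqrt_apply_sq {A : H →L[ℂ] H} (hA : 0 ≤ A) (v : H) :
    ‖CFC.sqrt A v‖ ^ 2 = (inner ℂ v (A v)).re := by
  rw [← inner_sqrt hA, inner_self_eq_norm_sq_to_K]
  norm_cast

lemma norm_inner_sqrt_le {F : H →L[ℂ] H} {M : ℝ} (hM : ‖F‖ ≤ M) (A : H →L[ℂ] H) (u v : H) :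
    ‖inner ℂ (CFC.sqrt A u) (F (CFC.sqrt A v))‖ ≤
      M * (‖CFC.sqrt A u‖ ^ 2 + ‖CFC.sqrt A v‖ ^ 2) := by
  calc _ ≤ ‖CFC.sqrt A u‖ * ‖F (CFC.sqrt A v)‖ := norm_inner_le_norm _ _
    _ ≤ ‖CFC.sqrt A u‖ * (M * ‖CFC.sqrt A v‖) := by
        gcongr
        exact F.le_of_opNorm_le hM _
    _ = M * (‖CFC.sqrt A u‖ * ‖CFC.sqrt A v‖) := by ring
    _ ≤ _ := by
        have : 0 ≤ M := (norm_nonneg _).trans hM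
        gcongr
        exact mul_le_sq_add_sq _ _

lemma norm_inner_sqrt_self_le {F : H →L[ℂ] H} {M : ℝ} (hM : ‖F‖ ≤ M) (A : H →L[ℂ] H) (v : H) :
    ‖inner ℂ (CFC.sqrt A v) (F (CFC.sqrt A v))‖ ≤ M * ‖CFC.sqrt A v‖ ^ 2 := by
  calc _ ≤ ‖CFC.sqrt A v‖ * ‖F (CFC.sqrt A v)‖ := norm_inner_le_norm _ _
    _ ≤ ‖CFC.sqrt A v‖ * (M * ‖CFC.sqrt A v‖) := by
        gcongr
        exact F.le_of_opNorm_le hM _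
    _ = _ := by ring

namespace POVM.IsRNDeriv

lemma setIntegral_inner (hD : ν.IsRNDeriv ρ D) {u v : H}
    (hu : u ∈ Submodule.span ℂ (Set.range b)) (hv : v ∈ Submodule.span ℂ (Set.range b)) :
    Integrable (fun x => inner ℂ u (D x v)) (ν.inducedMeasure ρ) ∧
    ∀ E, MeasurableSet E →
      ∫ x in E, inner ℂ u (D x v) ∂ν.inducedMeasure ρ = inner ℂ u (ν.toFun E v) := by
  induction hu using Submodule.span_induction with
  | zero => simp
  | add u w _ _ hu hw =>
    simp only [inner_add_left]
    refine ⟨hu.1.add hw.1, fun E hE => ?_⟩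
    rw [integral_add hu.1.integrableOn hw.1.integrableOn, hu.2 E hE, hw.2 E hE]
  | smul c u _ hu =>
    simp only [inner_smul_left]
    refine ⟨hu.1.const_mul _, fun E hE => ?_⟩
    rw [integral_const_mul, hu.2 E hE]
  | mem u hu =>
    obtain ⟨i, rfl⟩ := hu
    induction hv using Submodule.span_induction with
    | zero => simp
    | add u w _ _ hu hw =>
      simp only [map_add, inner_add_right]
      refine ⟨hu.1.add hw.1, fun E hE => ?_⟩
      rw [integral_add hu.1.integrableOn hw.1.integrableOn, hu.2 E hE, hw.2 E hE]
    | smul c u _ hu =>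
      simp only [map_smul, inner_smul_right]
      refine ⟨hu.1.const_mul _, fun E hE => ?_⟩
      rw [integral_const_mul, hu.2 E hE]
    | mem v hv =>
      obtain ⟨j, rfl⟩ := hv
      exact ⟨hD.integrable i j, hD.setIntegral_eq i j⟩

lemma ae_inner_nonneg (hD : ν.IsRNDeriv ρ D) {v : H}
    (hv : v ∈ Submodule.span ℂ (Set.range b)) : ∀ᵐ x ∂ν.inducedMeasure ρ,
    0 ≤ (inner ℂ v (D x v)).re ∧ (inner ℂ v (D x v)).im = 0 := by
  obtain ⟨hi, hE⟩ := hD.setIntegral_inner hv hv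
  have h1 : 0 ≤ᵐ[ν.inducedMeasure ρ] fun x => (inner ℂ v (D x v)).re := by
    refine ae_nonneg_of_forall_setIntegral_nonneg hi.re fun E hm _ => ?_
    have h2 : ∫ x in E, (inner ℂ v (D x v)).re ∂ν.inducedMeasure ρ
        = (inner ℂ v (ν.toFun E v)).re := by
      rw [← hE E hm]
      exact integral_re hi.integrableOn
    exact h2 ▸ (nonneg_iff_inner.1 (ν.nonneg E hm) v).1
  have h2 : (fun x => (inner ℂ v (D x v)).im) =ᵐ[ν.inducedMeasure ρ] 0 := by
    refine Integrable.ae_eq_zero_of_forall_setIntegral_eq_zero hi.im fun E hm _ => ?_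
    have h2 : ∫ x in E, (inner ℂ v (D x v)).im ∂ν.inducedMeasure ρ
        = (inner ℂ v (ν.toFun E v)).im := by
      rw [← hE E hm]
      exact integral_im hi.integrableOn
    exact h2.trans (nonneg_iff_inner.1 (ν.nonneg E hm) v).2
  filter_upwards [h1, h2] with x hx1 hx2
  exact ⟨hx1, hx2⟩

/-! ### Almost everywhere positivity of `D` and second moments of `D^{1/2}` -/

variable [TopologicalSpace.SeparableSpace H]

/-- The exceptional null set of `ae_inner_nonneg` depends on the vector, so countably many vectors
are used: a dense sequence inside the span of the basis. -/
lemma ae_nonneg (hD : ν.IsRNDeriv ρ D) : ∀ᵐ x ∂ν.inducedMeasure ρ, 0 ≤ D x := by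
  have := UniformSpace.secondCountable_of_separable H
  let S := Submodule.span ℂ (Set.range b)
  have hS : DenseRange (Subtype.val : S → H) := by
    rw [denseRange_subtype_val]
    exact Submodule.dense_iff_topologicalClosure_eq_top.2 b.dense_span
  have hd := hS.comp (TopologicalSpace.denseRange_denseSeq S) continuous_subtype_val
  simp only [nonneg_iff_inner_of_denseRange hd]
  exact ae_all_iff.2 fun n => hD.ae_inner_nonneg (TopologicalSpace.denseSeq S n).2

lemma weaklyMeasurable (hD : ν.IsRNDeriv ρ D) : WeaklyMeasurable D :=
  (isQuantumRandomVariable_iff b).1 hD.isQuantumRandomVariable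

lemma weaklyMeasurable_sqrt (hD : ν.IsRNDeriv ρ D) :
    WeaklyMeasurable fun x => CFC.sqrt (D x) := hD.weaklyMeasurable.sqrt b

lemma measurable_norm_sqrt_sq (hD : ν.IsRNDeriv ρ D) (v : H) :
    Measurable fun x => ‖CFC.sqrt (D x) v‖ ^ 2 := by
  have h : ∀ x, ‖CFC.sqrt (D x) v‖ ^ 2 =
      (inner ℂ v ((CFC.sqrt (D x) * CFC.sqrt (D x)) v)).re := fun x => by
    rw [mul_apply_eq_comp, ← inner_sqrt_left, inner_self_eq_norm_sq_to_K]
    norm_cast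
  simp only [h]
  exact Complex.measurable_re.comp
    (hD.weaklyMeasurable_sqrt.mul b hD.weaklyMeasurable_sqrt v v)

/-- For `v` in the span of the basis the left side is `⟨v, ν(X) v⟩`. For other `v`, approximate from
the span and apply Fatou's lemma. -/
lemma lintegral_norm_sqrt_sq_le (hD : ν.IsRNDeriv ρ D) (v : H) :
    ∫⁻ x, ENNReal.ofReal (‖CFC.sqrt (D x) v‖ ^ 2) ∂ν.inducedMeasure ρ ≤
      ENNReal.ofReal (‖ν.toFun Set.univ‖ * ‖v‖ ^ 2) := by
  have hcl : v ∈ closure (Submodule.span ℂ (Set.range b) : Set H) :=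
    (Submodule.dense_iff_topologicalClosure_eq_top.2 b.dense_span) v
  obtain ⟨w, hw, hlim⟩ := mem_closure_iff_seq_limit.1 hcl
  have hle : ∀ n, ∫⁻ x, ENNReal.ofReal (‖CFC.sqrt (D x) (w n)‖ ^ 2) ∂ν.inducedMeasure ρ ≤
      ENNReal.ofReal (‖ν.toFun Set.univ‖ * ‖w n‖ ^ 2) := by
    intro n
    obtain ⟨hi, hE⟩ := hD.setIntegral_inner (hw n) (hw n)
    have h1 : ∫⁻ x, ENNReal.ofReal (‖CFC.sqrt (D x) (w n)‖ ^ 2) ∂ν.inducedMeasure ρ =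
        ∫⁻ x, ENNReal.ofReal (inner ℂ (w n) (D x (w n))).re ∂ν.inducedMeasure ρ := by
      refine lintegral_congr_ae ?_
      filter_upwards [hD.ae_nonneg] with x hx
      rw [norm_sqrt_apply_sq hx]
    have h2 : ∫ x, (inner ℂ (w n) (D x (w n))).re ∂ν.inducedMeasure ρ
        = (inner ℂ (w n) (ν.toFun Set.univ (w n))).re := by
      rw [← hE _ MeasurableSet.univ, Measure.restrict_univ]
      exact integral_re hi
    have hr : Integrable (fun x => (inner ℂ (w n) (D x (w n))).re) (ν.inducedMeasure ρ) := hi.re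
    rw [h1, ← ofReal_integral_eq_lintegral_ofReal hr
      ((hD.ae_inner_nonneg (hw n)).mono fun x hx => hx.1)]
    refine ENNReal.ofReal_le_ofReal (h2.le.trans ((Complex.re_le_norm _).trans ?_))
    refine (norm_inner_le_norm _ _).trans ?_
    calc ‖w n‖ * ‖ν.toFun Set.univ (w n)‖ ≤ ‖w n‖ * (‖ν.toFun Set.univ‖ * ‖w n‖) := by
          gcongr
          exact ContinuousLinearMap.le_opNorm _ _
      _ = _ := by ring
  have hpt : ∀ x, Tendsto (fun n => ENNReal.ofReal (‖CFC.sqrt (D x) (w n)‖ ^ 2)) atTop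
      (𝓝 (ENNReal.ofReal (‖CFC.sqrt (D x) v‖ ^ 2))) := fun x => by
    have hc : Continuous fun v => ENNReal.ofReal (‖CFC.sqrt (D x) v‖ ^ 2) :=
      ENNReal.continuous_ofReal.comp (by fun_prop)
    exact (hc.tendsto v).comp hlim
  have hr : Tendsto (fun n => ENNReal.ofReal (‖ν.toFun Set.univ‖ * ‖w n‖ ^ 2)) atTop
      (𝓝 (ENNReal.ofReal (‖ν.toFun Set.univ‖ * ‖v‖ ^ 2))) := by
    have hc : Continuous fun v : H => ENNReal.ofReal (‖ν.toFun Set.univ‖ * ‖v‖ ^ 2) :=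
      ENNReal.continuous_ofReal.comp (by fun_prop)
    exact (hc.tendsto v).comp hlim
  calc ∫⁻ x, ENNReal.ofReal (‖CFC.sqrt (D x) v‖ ^ 2) ∂ν.inducedMeasure ρ
      = ∫⁻ x, liminf (fun n => ENNReal.ofReal (‖CFC.sqrt (D x) (w n)‖ ^ 2)) atTop
          ∂ν.inducedMeasure ρ := lintegral_congr fun x => (hpt x).liminf_eq.symm
    _ ≤ liminf (fun n => ∫⁻ x, ENNReal.ofReal (‖CFC.sqrt (D x) (w n)‖ ^ 2)
          ∂ν.inducedMeasure ρ) atTop :=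
        lintegral_liminf_le fun n => (hD.measurable_norm_sqrt_sq (w n)).ennreal_ofReal
    _ ≤ liminf (fun n => ENNReal.ofReal (‖ν.toFun Set.univ‖ * ‖w n‖ ^ 2)) atTop :=
        liminf_le_liminf (Eventually.of_forall hle)
    _ = _ := hr.liminf_eq

lemma integrable_norm_sqrt_sq (hD : ν.IsRNDeriv ρ D) (v : H) :
    Integrable (fun x => ‖CFC.sqrt (D x) v‖ ^ 2) (ν.inducedMeasure ρ) := by
  refine ⟨(hD.measurable_norm_sqrt_sq v).aestronglyMeasurable, ?_⟩
  rw [hasFiniteIntegral_iff_ofReal (Eventually.of_forall fun x => sq_nonneg _)]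
  exact (hD.lintegral_norm_sqrt_sq_le v).trans_lt ENNReal.ofReal_lt_top

lemma integral_norm_sqrt_sq_le (hD : ν.IsRNDeriv ρ D) (v : H) :
    ∫ x, ‖CFC.sqrt (D x) v‖ ^ 2 ∂ν.inducedMeasure ρ ≤ ‖ν.toFun Set.univ‖ * ‖v‖ ^ 2 := by
  have h := hD.lintegral_norm_sqrt_sq_le v
  rw [← ofReal_integral_eq_lintegral_ofReal (hD.integrable_norm_sqrt_sq v)
    (Eventually.of_forall fun x => sq_nonneg _)] at h
  exact (ENNReal.ofReal_le_ofReal_iff (by positivity)).1 h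

lemma integrable_tsum_norm_sqrt_sq (hD : ν.IsRNDeriv ρ D) {S : H →L[ℂ] H}
    (hS : IsHilbertSchmidt b S) :
    Integrable (fun x => ∑' i, ‖CFC.sqrt (D x) (S (b i))‖ ^ 2) (ν.inducedMeasure ρ) := by
  have := countable_of_hilbertBasis b
  have hsum : ∀ x, Summable fun i => ‖CFC.sqrt (D x) (S (b i))‖ ^ 2 := fun x =>
    hS.mul_left (CFC.sqrt (D x))
  have hm : Measurable fun x => ∑' i, ‖CFC.sqrt (D x) (S (b i))‖ ^ 2 :=
    measurable_of_hasSum (fun i => hD.measurable_norm_sqrt_sq (S (b i))) fun x => (hsum x).hasSum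
  refine ⟨hm.aestronglyMeasurable, ?_⟩
  rw [hasFiniteIntegral_iff_ofReal
    (Eventually.of_forall fun x => tsum_nonneg fun i => sq_nonneg _)]
  simp only [fun x => ENNReal.ofReal_tsum_of_nonneg (fun i => sq_nonneg _) (hsum x)]
  rw [lintegral_tsum fun i => (hD.measurable_norm_sqrt_sq _).ennreal_ofReal.aemeasurable]
  refine (ENNReal.tsum_le_tsum fun i => hD.lintegral_norm_sqrt_sq_le (S (b i))).trans_lt ?_
  rw [← ENNReal.ofReal_tsum_of_nonneg (fun i => by positivity) (Summable.mul_left _ hS)]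
  exact ENNReal.ofReal_lt_top

/-! ### Integrability and existence of the integral -/

lemma measurable_inner_sqrt (hD : ν.IsRNDeriv ρ D) {F : X → (H →L[ℂ] H)}
    (hF : WeaklyMeasurable F) (u v : H) :
    Measurable fun x => inner ℂ (CFC.sqrt (D x) u) (F x (CFC.sqrt (D x) v)) := by
  simp only [inner_sqrt_left]
  exact hD.weaklyMeasurable_sqrt.mul b (hF.mul b hD.weaklyMeasurable_sqrt) u v

lemma integrable_inner_sqrt (hD : ν.IsRNDeriv ρ D) {F : X → (H →L[ℂ] H)}
    (hF : WeaklyMeasurable F) {M : ℝ} (hM : ∀ᵐ x ∂ν.inducedMeasure ρ, ‖F x‖ ≤ M) (u v : H) :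
    Integrable (fun x => inner ℂ (CFC.sqrt (D x) u) (F x (CFC.sqrt (D x) v)))
      (ν.inducedMeasure ρ) := by
  refine Integrable.mono' (((hD.integrable_norm_sqrt_sq u).add
    (hD.integrable_norm_sqrt_sq v)).const_mul M)
    (hD.measurable_inner_sqrt hF u v).aestronglyMeasurable ?_
  filter_upwards [hM] with x hx
  exact norm_inner_sqrt_le hx _ _ _

lemma norm_integral_inner_sqrt_le (hD : ν.IsRNDeriv ρ D) {F : X → (H →L[ℂ] H)}
    {M : ℝ} (hM0 : 0 ≤ M) (hM : ∀ᵐ x ∂ν.inducedMeasure ρ, ‖F x‖ ≤ M) (u v : H) :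
    ‖∫ x, inner ℂ (CFC.sqrt (D x) u) (F x (CFC.sqrt (D x) v)) ∂ν.inducedMeasure ρ‖ ≤
      M * ‖ν.toFun Set.univ‖ * (‖u‖ ^ 2 + ‖v‖ ^ 2) := by
  calc _ ≤ ∫ x, M * (‖CFC.sqrt (D x) u‖ ^ 2 + ‖CFC.sqrt (D x) v‖ ^ 2) ∂ν.inducedMeasure ρ := by
        refine norm_integral_le_of_norm_le (((hD.integrable_norm_sqrt_sq u).add
          (hD.integrable_norm_sqrt_sq v)).const_mul M) ?_
        filter_upwards [hM] with x hx
        exact norm_inner_sqrt_le hx _ _ _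
    _ = M * (∫ x, ‖CFC.sqrt (D x) u‖ ^ 2 ∂ν.inducedMeasure ρ +
          ∫ x, ‖CFC.sqrt (D x) v‖ ^ 2 ∂ν.inducedMeasure ρ) := by
        rw [integral_const_mul, integral_add (hD.integrable_norm_sqrt_sq u)
          (hD.integrable_norm_sqrt_sq v)]
    _ ≤ M * (‖ν.toFun Set.univ‖ * ‖u‖ ^ 2 + ‖ν.toFun Set.univ‖ * ‖v‖ ^ 2) := by
        gcongr
        exacts [hD.integral_norm_sqrt_sq_le u, hD.integral_norm_sqrt_sq_le v]
    _ = _ := by ring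

/-- The operator that represents the sesquilinear form `∫ ⟨D^{1/2} u, F D^{1/2} v⟩ dν_ρ`. -/
lemma exists_operator (hD : ν.IsRNDeriv ρ D) {F : X → (H →L[ℂ] H)}
    (hF : WeaklyMeasurable F) {M : ℝ} (hM : ∀ᵐ x ∂ν.inducedMeasure ρ, ‖F x‖ ≤ M) :
    ∃ A : H →L[ℂ] H, ∀ u v, inner ℂ u (A v) =
      ∫ x, inner ℂ (CFC.sqrt (D x) u) (F x (CFC.sqrt (D x) v)) ∂ν.inducedMeasure ρ := by
  -- `M` may be negative when `ν_ρ = 0`.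
  have hM' : ∀ᵐ x ∂ν.inducedMeasure ρ, ‖F x‖ ≤ |M| := hM.mono fun x hx => hx.trans (le_abs_self M)
  have hi := hD.integrable_inner_sqrt hF hM
  let B : H →ₗ⋆[ℂ] H →ₗ[ℂ] ℂ := LinearMap.mk₂'ₛₗ (starRingEnd ℂ) (RingHom.id ℂ)
    (fun u v => ∫ x, inner ℂ (CFC.sqrt (D x) u) (F x (CFC.sqrt (D x) v)) ∂ν.inducedMeasure ρ)
    (fun u w v => by
      simp only [map_add, inner_add_left]
      exact integral_add (hi u v) (hi w v))
    (fun c u v => by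
      simp only [map_smul, inner_smul_left, smul_eq_mul]
      exact integral_const_mul _ _)
    (fun u v w => by
      simp only [map_add, inner_add_right]
      exact integral_add (hi u v) (hi u w))
    (fun c u v => by
      simp only [map_smul, inner_smul_right, smul_eq_mul, RingHom.id_apply]
      exact integral_const_mul _ _)
  have hB : ∀ u v, B u v =
      ∫ x, inner ℂ (CFC.sqrt (D x) u) (F x (CFC.sqrt (D x) v)) ∂ν.inducedMeasure ρ :=
    fun _ _ => rfl
  have hbound : ∀ u v, ‖B u v‖ ≤ 2 * (|M| * ‖ν.toFun Set.univ‖) * ‖u‖ * ‖v‖ := by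
    intro u v
    by_cases hu : u = 0
    · simp [hu]
    by_cases hv : v = 0
    · simp [hv]
    have hnu : ‖u‖ ≠ 0 := norm_ne_zero_iff.2 hu
    have hnv : ‖v‖ ≠ 0 := norm_ne_zero_iff.2 hv
    have hn : ∀ w : H, ‖w‖ ≠ 0 → ‖((‖w‖⁻¹ : ℝ) : ℂ) • w‖ = 1 := fun w hw => by
      rw [norm_smul]
      simp [hw]
    -- On unit vectors `‖u‖² + ‖v‖²` equals `2`; homogeneity turns this into the factor `2` of
    -- `hbound`.
    have h := hD.norm_integral_inner_sqrt_le (abs_nonneg M) hM' (((‖u‖⁻¹ : ℝ) : ℂ) • u)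
      (((‖v‖⁻¹ : ℝ) : ℂ) • v)
    rw [← hB, LinearMap.map_smulₛₗ₂, map_smul, hn u hnu, hn v hnv, smul_smul, norm_smul] at h
    simp only [norm_mul, RCLike.norm_conj, Complex.norm_real, norm_inv, norm_norm] at h
    rw [← mul_inv, inv_mul_le_iff₀ (by positivity)] at h
    linarith
  let B' : H →L⋆[ℂ] H →L[ℂ] ℂ := LinearMap.mkContinuous₂ B _ hbound
  refine ⟨ContinuousLinearMap.adjoint (InnerProductSpace.continuousLinearMapOfBilin B'),
    fun u v => ?_⟩
  rw [ContinuousLinearMap.adjoint_inner_right,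
    InnerProductSpace.continuousLinearMapOfBilin_apply]
  rfl

end POVM.IsRNDeriv

end QuantumExpectation

namespace QuantumExpectation

variable {H : Type*} [NormedAddCommGroup H] [InnerProductSpace ℂ H] [CompleteSpace H]
variable {ι : Type*} {X : Type*} [MeasurableSpace X]
variable {b : HilbertBasis ι ℂ H} {ν : POVM X b} {ρ : State b} {D : X → (H →L[ℂ] H)}

/-! ### Traces against states -/

lemma State.isHilbertSchmidt_sqrt (s : State b) : IsHilbertSchmidt b (CFC.sqrt s.op) :=
  summable_sqrt s.nonneg s.isTraceClass

set_option linter.unusedSectionVars false in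
lemma hasSum_scalarDensity (D f : X → (H →L[ℂ] H)) (s : State b) (x : X) :
    HasSum (fun i => inner ℂ (CFC.sqrt (D x) (CFC.sqrt s.op (b i)))
      (f x (CFC.sqrt (D x) (CFC.sqrt s.op (b i))))) (scalarDensity D f s x) := by
  have h := (hasSum_trace_mul s.nonneg s.isTraceClass
    (CFC.sqrt (D x) * f x * CFC.sqrt (D x))).2
  unfold scalarDensity
  rw [← mul_assoc, ← mul_assoc] at h
  simpa only [inner_sqrt_left, mul_apply_eq_comp] using h

lemma sqrt_conj_eq (A : H →L[ℂ] H) (s : State b) :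
    CFC.sqrt A * s.op * CFC.sqrt A =
      star (CFC.sqrt s.op * CFC.sqrt A) * (CFC.sqrt s.op * CFC.sqrt A) := by
  rw [star_mul, (isSelfAdjoint_sqrt A).star_eq, (isSelfAdjoint_sqrt s.op).star_eq, mul_assoc,
    mul_assoc, ← mul_assoc (CFC.sqrt s.op), CFC.sqrt_mul_sqrt_self _ s.nonneg]

/-- With `C = s^{1/2} D^{1/2}`, which is Hilbert–Schmidt, this is `tr(C* · C f) = tr(C f · C*)`. -/
lemma trace_sqrt_conj_mul (D f : X → (H →L[ℂ] H)) (s : State b) (x : X) :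
    HasSum (fun i => inner ℂ (b i) ((CFC.sqrt (D x) * s.op * CFC.sqrt (D x) * f x) (b i)))
      (scalarDensity D f s x) := by
  obtain ⟨C, hCe⟩ : ∃ C, C = CFC.sqrt s.op * CFC.sqrt (D x) := ⟨_, rfl⟩
  have hC : IsHilbertSchmidt b C := hCe ▸ s.isHilbertSchmidt_sqrt.mul_right _
  have hst : star C = CFC.sqrt (D x) * CFC.sqrt s.op := by
    rw [hCe, star_mul, (isSelfAdjoint_sqrt _).star_eq, (isSelfAdjoint_sqrt _).star_eq]
  obtain ⟨h1, h2⟩ := hC.hasSum_inner (hC.mul_right (f x))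
  have e1 : ∀ i, inner ℂ (C (b i)) ((C * f x) (b i)) =
      inner ℂ (b i) ((CFC.sqrt (D x) * s.op * CFC.sqrt (D x) * f x) (b i)) := fun i => by
    rw [sqrt_conj_eq, ← hCe, mul_assoc, mul_apply_eq_comp (star C),
      ContinuousLinearMap.star_eq_adjoint, ContinuousLinearMap.adjoint_inner_right]
  have e2 : ∀ i, inner ℂ (star (C * f x) (b i)) (star C (b i)) =
      inner ℂ (CFC.sqrt (D x) (CFC.sqrt s.op (b i)))
      (f x (CFC.sqrt (D x) (CFC.sqrt s.op (b i)))) := fun i => by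
    rw [star_mul, mul_apply_eq_comp, ContinuousLinearMap.star_eq_adjoint (f x),
      ContinuousLinearMap.adjoint_inner_left, hst, mul_apply_eq_comp]
  simp only [e1] at h1
  simp only [e2] at h2
  rwa [h2.unique (hasSum_scalarDensity D f s x)] at h1

set_option linter.unusedSectionVars false in
lemma trace_sum_smul {κ : Type*} [Fintype κ] (c : κ → ℂ) {T : κ → H →L[ℂ] H} {t : κ → ℂ}
    (h : ∀ k, HasSum (fun i => inner ℂ (b i) (T k (b i))) (t k)) :
    trace b (∑ k, c k • T k) = ∑ k, c k * t k := by
  have hs : HasSum (fun i => ∑ k, c k * inner ℂ (b i) (T k (b i))) (∑ k, c k * t k) :=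
    hasSum_sum fun k _ => (h k).mul_left (c k)
  rw [← hs.tsum_eq, trace]
  simp only [sum_apply, smul_apply, inner_sum, inner_smul_right]

/-! ### Integrability and existence of the integral -/

namespace POVM.IsRNDeriv

variable [TopologicalSpace.SeparableSpace H]

lemma integrable_scalarDensity (hD : ν.IsRNDeriv ρ D) {F : X → (H →L[ℂ] H)}
    (hF : WeaklyMeasurable F) {M : ℝ} (hM : ∀ᵐ x ∂ν.inducedMeasure ρ, ‖F x‖ ≤ M) :
    ν.IntegrablePos ρ D F := by
  intro s
  have := countable_of_hilbertBasis b
  have hm : Measurable (scalarDensity D F s) :=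
    measurable_of_hasSum (fun i => hD.measurable_inner_sqrt hF _ _)
      (hasSum_scalarDensity D F s)
  refine Integrable.mono' ((hD.integrable_tsum_norm_sqrt_sq s.isHilbertSchmidt_sqrt).const_mul M)
    hm.aestronglyMeasurable ?_
  filter_upwards [hM] with x hx
  have hs : Summable fun i => ‖CFC.sqrt (D x) (CFC.sqrt s.op (b i))‖ ^ 2 :=
    s.isHilbertSchmidt_sqrt.mul_left (CFC.sqrt (D x))
  rw [← (hasSum_scalarDensity D F s x).tsum_eq, ← tsum_mul_left]
  exact tsum_of_norm_bounded (Summable.mul_left M hs).hasSum fun i => norm_inner_sqrt_self_le hx _ _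

/-- Both sides are sums over the vectors `s^{1/2} e_i`. Sum and integral commute because the `i`-th
term has `L¹` norm at most `|M| ‖ν(X)‖ ‖s^{1/2} e_i‖²`. -/
lemma trace_mul_eq_integral (hD : ν.IsRNDeriv ρ D) {F : X → (H →L[ℂ] H)}
    (hF : WeaklyMeasurable F) {M : ℝ} (hM : ∀ᵐ x ∂ν.inducedMeasure ρ, ‖F x‖ ≤ M)
    {A : H →L[ℂ] H} (hA : ∀ v, inner ℂ v (A v) =
      ∫ x, inner ℂ (CFC.sqrt (D x) v) (F x (CFC.sqrt (D x) v)) ∂ν.inducedMeasure ρ)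
    (s : State b) : trace b (s.op * A) = ∫ x, scalarDensity D F s x ∂ν.inducedMeasure ρ := by
  have := countable_of_hilbertBasis b
  have hM' : ∀ᵐ x ∂ν.inducedMeasure ρ, ‖F x‖ ≤ |M| := hM.mono fun x hx => hx.trans (le_abs_self M)
  have h1 := (hasSum_trace_mul s.nonneg s.isTraceClass A).2
  simp only [hA] at h1
  have h2 := hasSum_integral_of_summable_integral_norm
    (fun i => hD.integrable_inner_sqrt hF hM (CFC.sqrt s.op (b i)) (CFC.sqrt s.op (b i))) <| by
      refine Summable.of_nonneg_of_le (fun i => integral_nonneg fun x => norm_nonneg _) (fun i => ?_)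
        (Summable.mul_left (|M| * ‖ν.toFun Set.univ‖) s.isHilbertSchmidt_sqrt)
      calc _ ≤ ∫ x, |M| * ‖CFC.sqrt (D x) (CFC.sqrt s.op (b i))‖ ^ 2 ∂ν.inducedMeasure ρ := by
            refine integral_mono_ae (hD.integrable_inner_sqrt hF hM _ _).norm
              ((hD.integrable_norm_sqrt_sq _).const_mul _) ?_
            filter_upwards [hM'] with x hx
            exact norm_inner_sqrt_self_le hx _ _
        _ ≤ |M| * (‖ν.toFun Set.univ‖ * ‖CFC.sqrt s.op (b i)‖ ^ 2) := by
            rw [integral_const_mul]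
            gcongr
            exact hD.integral_norm_sqrt_sq_le _
        _ = _ := by ring
  simp only [fun x => (hasSum_scalarDensity D F s x).tsum_eq] at h2
  exact h1.unique h2

lemma exists_hasQIntegral (hD : ν.IsRNDeriv ρ D) (f : ν.EssBounded) :
    ∃ A, ν.HasQIntegral ρ D f.1 A := by
  obtain ⟨hq, M, hM⟩ := f.2
  replace hM := hM.filter_mono (ν.ae_inducedMeasure_le ρ)
  have hF := (isQuantumRandomVariable_iff b).1 hq
  obtain ⟨A, hA⟩ := hD.exists_operator hF hM
  have hre : ∀ᵐ x ∂ν.inducedMeasure ρ, ‖(ℜ (f.1 x) : H →L[ℂ] H)‖ ≤ M :=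
    hM.mono fun x hx => (realPart.norm_le _).trans hx
  have him : ∀ᵐ x ∂ν.inducedMeasure ρ, ‖(ℑ (f.1 x) : H →L[ℂ] H)‖ ≤ M :=
    hM.mono fun x hx => (imaginaryPart.norm_le _).trans hx
  -- The integral comes from `f` directly; the four parts need only integrability, and each has norm
  -- at most `‖f x‖`.
  refine ⟨A, ⟨?_, ?_, ?_, ?_⟩, hD.trace_mul_eq_integral hF hM fun v => hA v v⟩
  · exact hD.integrable_scalarDensity (hF.realPart.posPart b fun x => (ℜ (f.1 x)).2)
      (hre.mono fun x hx => (CStarAlgebra.norm_posPart_le _).trans hx)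
  · exact hD.integrable_scalarDensity (hF.realPart.negPart b fun x => (ℜ (f.1 x)).2)
      (hre.mono fun x hx => (CStarAlgebra.norm_negPart_le _).trans hx)
  · exact hD.integrable_scalarDensity (hF.imaginaryPart.posPart b fun x => (ℑ (f.1 x)).2)
      (him.mono fun x hx => (CStarAlgebra.norm_posPart_le _).trans hx)
  · exact hD.integrable_scalarDensity (hF.imaginaryPart.negPart b fun x => (ℑ (f.1 x)).2)
      (him.mono fun x hx => (CStarAlgebra.norm_negPart_le _).trans hx)

end POVM.IsRNDeriv

/-- Pure states determine the quadratic form, which determines the operator over `ℂ`. This is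
uniqueness of the integral. -/
lemma eq_of_trace_state_mul_eq (b : HilbertBasis ι ℂ H) {A B : H →L[ℂ] H}
    (h : ∀ s : State b, trace b (s.op * A) = trace b (s.op * B)) : A = B := by
  have h1 : ∀ v, inner ℂ v (A v) = inner ℂ v (B v) := by
    intro v
    by_cases hv : v = 0
    · simp [hv]
    have hn : ‖v‖ ≠ 0 := norm_ne_zero_iff.mpr hv
    have hu : ‖((‖v‖⁻¹ : ℝ) : ℂ) • v‖ = 1 := by
      rw [norm_smul]
      simp [hn]
    have h2 := h (pureState b _ hu)
    simpa [trace_pureState, inner_smul_left, inner_smul_right, hv] using h2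
  have h2 : (A : H →ₗ[ℂ] H) = B := by
    refine (ext_inner_map _ _).1 fun v => ?_
    rw [← inner_conj_symm, ← inner_conj_symm _ v]
    exact congrArg _ (h1 v)
  exact ContinuousLinearMap.coe_injective h2

namespace POVM.IsRNDeriv

variable [TopologicalSpace.SeparableSpace H]

lemma hasQIntegral_expectation (hD : ν.IsRNDeriv ρ D) (f : ν.EssBounded) :
    ν.HasQIntegral ρ D f.1 (ν.expectation ρ D (Submodule.Quotient.mk f)) := by
  have h := hD.exists_hasQIntegral f
  have e : ν.expectation ρ D (Submodule.Quotient.mk f) = h.choose := by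
    change ν.qIntegral ρ D f.1 = _
    rw [qIntegral, dif_pos h]
  rw [e]
  exact h.choose_spec

lemma hasQIntegral_iff (hD : ν.IsRNDeriv ρ D) (f : ν.EssBounded) (A : H →L[ℂ] H) :
    ν.HasQIntegral ρ D f.1 A ↔ A = ν.expectation ρ D (Submodule.Quotient.mk f) := by
  have h := hD.hasQIntegral_expectation f
  refine ⟨fun hA => eq_of_trace_state_mul_eq b fun s => ?_, fun hA => hA ▸ h⟩
  rw [hA.2 s, h.2 s]

/-! ### The preadjoint `s ↦ D^{1/2} s D^{1/2}` -/

lemma memPredual (hD : ν.IsRNDeriv ρ D) {t : H →L[ℂ] H} (ht : IsTraceClass b t) :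
    ν.MemPredual ρ (fun x => CFC.sqrt (D x) * t * CFC.sqrt (D x)) := by
  have hR := hD.weaklyMeasurable_sqrt
  refine ⟨(isQuantumRandomVariable_iff b).2
    ((hR.mul b (WeaklyMeasurable.const t)).mul b hR), ?_⟩
  obtain ⟨c, s, rfl⟩ := ht.exists_eq_sum_state ρ
  have hQ : ∀ x k, IsHilbertSchmidt b (CFC.sqrt (s k).op * CFC.sqrt (D x)) := fun x k =>
    (s k).isHilbertSchmidt_sqrt.mul_right _
  -- Passing to the adjoint leaves the Hilbert–Schmidt norm unchanged and puts `D^{1/2}` on the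
  -- left, where `integrable_tsum_norm_sqrt_sq` applies.
  have hn : ∀ x k, ∑' i, ‖(CFC.sqrt (s k).op * CFC.sqrt (D x)) (b i)‖ ^ 2 =
      ∑' i, ‖CFC.sqrt (D x) (CFC.sqrt (s k).op (b i))‖ ^ 2 := fun x k => by
    rw [← (hQ x k).star.2, star_mul, (isSelfAdjoint_sqrt _).star_eq,
      (isSelfAdjoint_sqrt _).star_eq]
    rfl
  have hle : ∀ x, traceNorm b (CFC.sqrt (D x) * (∑ k, c k • (s k).op) * CFC.sqrt (D x)) ≤
      ENNReal.ofReal (∑ k, ‖c k‖ * (2 * ∑' i, ‖CFC.sqrt (D x) (CFC.sqrt (s k).op (b i))‖ ^ 2)) := by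
    intro x
    have h := traceNorm_sum_le c (hQ x)
    simp only [hn, ← sqrt_conj_eq] at h
    simpa only [Finset.mul_sum, Finset.sum_mul, mul_smul_comm, smul_mul_assoc] using h
  refine (lintegral_mono hle).trans_lt (Integrable.lintegral_lt_top ?_)
  exact integrable_finsetSum _ fun k _ =>
    ((hD.integrable_tsum_norm_sqrt_sq (s k).isHilbertSchmidt_sqrt).const_mul 2).const_mul _

/-- Both sides are linear in `t`, so states suffice; for a state `s` both equal `∫ f_s dν_ρ`, by
definition of the integral and by `trace_sqrt_conj_mul`. -/
lemma trace_mul_expectation (hD : ν.IsRNDeriv ρ D) {t : H →L[ℂ] H} (ht : IsTraceClass b t)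
    (q : ν.Linfty) : trace b (t * ν.expectation ρ D q) =
      ν.pairing ρ (fun x => CFC.sqrt (D x) * t * CFC.sqrt (D x)) q := by
  obtain ⟨f, rfl⟩ := Submodule.Quotient.mk_surjective _ q
  obtain ⟨c, s, rfl⟩ := ht.exists_eq_sum_state ρ
  obtain ⟨hq, M, hM⟩ := f.2
  have hi := hD.integrable_scalarDensity ((isQuantumRandomVariable_iff b).1 hq)
    (hM.filter_mono (ν.ae_inducedMeasure_le ρ))
  have h := (hD.hasQIntegral_expectation f).2
  change _ = ∫ x, trace b (CFC.sqrt (D x) * (∑ k, c k • (s k).op) * CFC.sqrt (D x) * f.1 x)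
    ∂ν.inducedMeasure ρ
  generalize ν.expectation ρ D (Submodule.Quotient.mk f) = A at h ⊢
  simp only [Finset.mul_sum, Finset.sum_mul, mul_smul_comm, smul_mul_assoc]
  rw [trace_sum_smul c fun k => (hasSum_trace_mul (s k).nonneg (s k).isTraceClass A).1]
  simp only [fun x => trace_sum_smul c fun k => trace_sqrt_conj_mul D f.1 (s k) x]
  rw [integral_finsetSum _ fun k _ => (hi (s k)).const_mul _]
  simp only [integral_const_mul, h]

lemma continuous_expectation (hD : ν.IsRNDeriv ρ D) :
    Continuous[ν.weakStar ρ, ultraweak b] (ν.expectation ρ D) := by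
  refine continuous_iInf_rng.2 fun t => continuous_induced_rng.2 ?_
  have e : (fun A => trace b (t.1 * A)) ∘ ν.expectation ρ D =
      ν.pairing ρ (fun x => CFC.sqrt (D x) * t.1 * CFC.sqrt (D x)) :=
    funext fun q => hD.trace_mul_expectation t.2 q
  rw [e]
  exact continuous_iInf_dom (i := ⟨_, hD.memPredual t.2⟩) continuous_induced_dom

end POVM.IsRNDeriv

end QuantumExpectation

theorem theorem2p6
    {H : Type*} [NormedAddCommGroup H] [InnerProductSpace ℂ H] [CompleteSpace H]
    [TopologicalSpace.SeparableSpace H]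
    {ι : Type*} (b : HilbertBasis ι ℂ H)
    {X : Type*} [MeasurableSpace X]
    (ν : POVM X b)
    (ρ : State b) (hρ : ρ.FullRank)
    (D : X → (H →L[ℂ] H)) (hD : ν.IsRNDeriv ρ D) :
    (∀ (f : ν.EssBounded) (A : H →L[ℂ] H),
      ν.HasQIntegral ρ D f.1 A ↔ A = ν.expectation ρ D (Submodule.Quotient.mk f)) ∧
    (∀ s : H →L[ℂ] H, IsTraceClass b s →
      ν.MemPredual ρ (fun x => CFC.sqrt (D x) * s * CFC.sqrt (D x))) ∧
    Continuous[ν.weakStar ρ, ultraweak b] (ν.expectation ρ D) :=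
  ⟨hD.hasQIntegral_iff, fun _ hs => hD.memPredual hs, hD.continuous_expectation⟩
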